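/- Notation. $\|\cdot\|$ and $(\cdot,\cdot)$ are the norm and inner product of the real space $L^2(0,1)$, whose elements are regarded as $1$-periodic functions, and $\partial_x$ is the periodic weak derivative. For $m\ge 1$, $\dot H^m_{per}(0,1)$ is the space of $f\in L^2(0,1)$ with $\int_0^1 f\,dx=0$ and $m$ successive periodic weak derivatives in $L^2(0,1)$. Let $w_1,w_2,\dots$ be a complete orthonormal system of eigenfunctions of $-\frac{d^2}{dx^2}$ in $\dot H^2_{per}(0,1)$ with eigenvalues $\lambda_1\le\lambda_2\le\cdots$. Let $\beta$ be a constant for the Gagliardo–Nirenberg inequality: $\|\partial_x^j u\|_{L^p(0,1)}\le\beta\|u\|^{1-\alpha}\|\partial_x^m u\|^{\alpha}$ for all $u\in\dot H^m_{per}(0,1)$, whenever $p>2$, $m\in\{1,2\}$, $j\in\{0,1,2,\dots\}$, $\alpha=\left(\frac12+j-\frac1p\right)m^{-1}$ and $\frac jm\le\alpha\le1$. Let $h\in L^2(0,1)$ with $\int_0^1h\,dx=0$, $\mu\in\mathbb R$ and $N\in\{0,1,2,\dots\}$. For a given $F:[0,\infty)\to L^2(0,1)$, a (weak) solution of $\partial_t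 v+\partial_x^3v+v\,\partial_xv-\partial_x^2v=F$ is a function $v\in C([0,\infty);\dot H^1_{per}(0,1))$ such that for every smooth $1$-periodic $\varphi$ and every $t\ge0$ $$(v(t),\varphi)-(v(0),\varphi)=\int_0^t\Big[(v(s),\varphi''')+\tfrac12(v(s)^2,\varphi')+(v(s),\varphi'')+(F(s),\varphi)\Big]ds .$$ Put $$\rho_1=\frac{2}{\lambda_1^2}\|h\|^2,\qquad \rho_2=\frac1{2^{1/3}}\big(3\beta^4\rho_1^{7/4}\big)^{4/3}+5\|h\|^2+\Big(\frac{\lambda_1}3\Big)^4+1,$$ $$M_0=\frac83\rho_2+\frac{16}{15}\Big(\frac13\beta^3\rho_1^{5/2}\Big)^{5/4},\qquad M_1=\lambda_1^{-1}\big(\mu\rho_1+\lambda_1^{-1}\|h\|^2\big),$$ and, for real $K,K_0,K_2$, $$M_2(K)=\mu K+\beta^{24/7}M_1^{11/7}+2\|h\|^2,\qquad M_3(K_0,K_2)=2\beta^4\lambda_1^{-3/4}\Big(K_0^2+\frac14K_2^2\Big).$$ Theorem. Let $v$ be a solution with $F=h$ and let $u$ be a solution of the feedback system, i.e. a solution with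 $F(t)=h-\mu\sum_{k=1}^N(u(t)-v(t),w_k)w_k$. Then: (a) $\|\partial_xv(t)\|^2\le M_0$ for all sufficiently large $t$. (b) Let $K_0,K_2$ be real numbers such that $\|\partial_xv(t)\|^2\le K_0$ for all sufficiently large $t$ (by (a), $K_0=M_0$ is possible), and such that $K_2=M_2(K_0)$ or $\|\partial_xu(t)\|^2\le K_2$ for all sufficiently large $t$. If $$M_3(K_0,K_2)\le2\mu\qquad\text{and}\qquad\lambda_{N+1}^{-1}M_3(K_0,K_2)\le\frac12,$$ then $\|u(t)-v(t)\|\to0$ exponentially as $t\to\infty$; precisely, there is $T\ge0$ with $\|u(t)-v(t)\|\le e^{-(t-T)}\|u(T)-v(T)\|$ for all $t\ge T$. In particular, (b) holds with $K_0=M_0$, $K_2=M_2(M_0)$. -/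

import Mathlib

open MeasureTheory Filter Topology
open scoped ContDiff

namespace KdVB

noncomputable section

/-- The real Hilbert space `L²(0,1)`; its elements are regarded as (classes of) 1-periodic
functions on the line. -/
abbrev L2 : Type := Lp ℝ 2 (volume.restrict (Set.Ioc (0 : ℝ) 1))

/-- Test functions: smooth 1-periodic functions on the line. -/
def IsTest (φ : ℝ → ℝ) : Prop := ContDiff ℝ ∞ φ ∧ Function.Periodic φ 1

/-- `g` is the weak derivative of `f` on the circle, i.e. in the sense of periodic
distributions. -/
def HasPerDeriv (f g : L2) : Prop :=
  ∀ φ : ℝ → ℝ, IsTest φ →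
    ∫ x in (0 : ℝ)..1, f x * deriv φ x = -∫ x in (0 : ℝ)..1, g x * φ x

open Classical in
/-- The (unique) periodic weak derivative `∂ₓ f` of `f`, when there is one in `L²`. -/
def dx (f : L2) : L2 := if hf : ∃ g, HasPerDeriv f g then hf.choose else 0

/-- `∫₀¹ f = 0`. -/
def MeanZero (f : L2) : Prop := ∫ x in (0 : ℝ)..1, f x = 0

/-- `f` belongs to the homogeneous periodic Sobolev space of order `m`: it has mean zero and `m`
successive periodic weak derivatives in `L²`. -/
def MemHdot (m : ℕ) (f : L2) : Prop :=
  (∀ i < m, ∃ g, HasPerDeriv (dx^[i] f) g) ∧ MeanZero f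

/-- `w₁, w₂, …` is a complete orthonormal system of eigenfunctions of `-d²/dx²` on the mean-zero
periodic functions, with eigenvalues `λ₁ ≤ λ₂ ≤ …` (the entries of index `0` are not used). -/
structure IsEigenbasis (w : ℕ → L2) (lam : ℕ → ℝ) : Prop where
  mem : ∀ k, 1 ≤ k → MemHdot 2 (w k)
  eigen : ∀ k, 1 ≤ k → -dx (dx (w k)) = lam k • w k
  orthonormal : ∀ j k, 1 ≤ j → 1 ≤ k → inner ℝ (w j) (w k) = if j = k then (1 : ℝ) else 0
  mono : ∀ j k, 1 ≤ j → j ≤ k → lam j ≤ lam k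
  complete : ∀ f : L2, MeanZero f → (∀ k, 1 ≤ k → inner ℝ f (w k) = 0) → f = 0

/-- `β` is a constant for the one-dimensional Gagliardo–Nirenberg inequality
`‖∂ₓʲ u‖_{Lᵖ} ≤ β ‖u‖^{1-α} ‖∂ₓᵐ u‖^α` on the mean-zero periodic Sobolev space of order `m`, for
all `p > 2`, `m = 1, 2` and `α = (1/2 + j - 1/p)/m` with `j/m ≤ α ≤ 1`. -/
def IsGNConst (β : ℝ) : Prop :=
  ∀ (p α : ℝ) (j m : ℕ), 2 < p → (m = 1 ∨ m = 2) → α = (1 / 2 + (j : ℝ) - 1 / p) / (m : ℝ) →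
    (j : ℝ) / (m : ℝ) ≤ α → α ≤ 1 → ∀ u : L2, MemHdot m u →
      eLpNorm (dx^[j] u) (ENNReal.ofReal p) (volume.restrict (Set.Ioc (0 : ℝ) 1)) ≤
        ENNReal.ofReal (β * ‖u‖ ^ (1 - α) * ‖dx^[m] u‖ ^ α)

/-- `v ∈ C([0,∞); Ḣ¹_per(0,1))` is a weak solution of `∂ₜv + ∂ₓ³v + v ∂ₓv - ∂ₓ²v = F`, with initial
value `v 0`. -/
structure IsSolution (F : ℝ → L2) (v : ℝ → L2) : Prop where
  mem : ∀ t, 0 ≤ t → MemHdot 1 (v t)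
  cont : ContinuousOn v (Set.Ici 0)
  cont_dx : ContinuousOn (fun t => dx (v t)) (Set.Ici 0)
  weak : ∀ φ : ℝ → ℝ, IsTest φ → ∀ t, 0 ≤ t →
    (∫ x in (0 : ℝ)..1, v t x * φ x) - (∫ x in (0 : ℝ)..1, v 0 x * φ x) =
      ∫ s in (0 : ℝ)..t, ∫ x in (0 : ℝ)..1,
        (v s x * iteratedDeriv 3 φ x + (v s x) ^ 2 / 2 * deriv φ x
          + v s x * iteratedDeriv 2 φ x + F s x * φ x)

/-- The right-hand side `h - μ ∑_{k=1}^N (u(t) - v(t), w_k) w_k` of the feedback system. -/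
def feedback (h : L2) (w : ℕ → L2) (μ : ℝ) (N : ℕ) (v u : ℝ → L2) (t : ℝ) : L2 :=
  h - μ • ∑ k ∈ Finset.Icc 1 N, (inner ℝ (u t - v t) (w k) : ℝ) • w k

/-! The constants; `l` stands for `λ₁` and `H` for `‖h‖`. -/

def rho1 (l H : ℝ) : ℝ := 2 / l ^ 2 * H ^ 2

def rho2 (β l H : ℝ) : ℝ :=
  1 / (2 : ℝ) ^ (1 / 3 : ℝ) * (3 * β ^ 4 * rho1 l H ^ (7 / 4 : ℝ)) ^ (4 / 3 : ℝ)
    + 5 * H ^ 2 + (l / 3) ^ 4 + 1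

def M0 (β l H : ℝ) : ℝ :=
  8 / 3 * rho2 β l H + 16 / 15 * (1 / 3 * β ^ 3 * rho1 l H ^ (5 / 2 : ℝ)) ^ (5 / 4 : ℝ)

def M1 (l H μ : ℝ) : ℝ := l⁻¹ * (μ * rho1 l H + l⁻¹ * H ^ 2)

/-- `M₂`, as a function of the bound `K` (such as `M₀`) for `‖∂ₓ v‖²`. -/
def M2 (β l H μ K : ℝ) : ℝ :=
  μ * K + β ^ (24 / 7 : ℝ) * M1 l H μ ^ (11 / 7 : ℝ) + 2 * H ^ 2

/-- `M₃`, as a function of the bounds `K₀` for `‖∂ₓ v‖²` and `K₂` for `‖∂ₓ u‖²`. -/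
def M3 (β l K₀ K₂ : ℝ) : ℝ := 2 * β ^ 4 * l ^ (-(3 / 4) : ℝ) * (K₀ ^ 2 + 1 / 4 * K₂ ^ 2)

end

end KdVB

/-!
The periodic Korteweg–de Vries–Burgers equation is diagonal in Fourier space up to its right-hand
side: the `k`-th coefficient of a solution satisfies a scalar linear equation whose forcing is the
coefficient of `F - v ∂ₓv`, and in the balance of its squared modulus the dispersive term `∂ₓ³v`
drops out (`IsModeSolution.mode_energy`). Summing these balances with Parseval's identity gives the
two energy inequalities used here without any further regularity of weak solutions:
`IsModeSolution.energy_le` for `‖v‖²`, and `IsModeSolution.energy_dx_le` for `‖∂ₓv‖²`, where the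
dissipation absorbs the forcing and leaves, by interpolation, `‖∂ₓv‖⁴ / ‖v‖²`. Weak derivatives are
handled through absolutely continuous representatives (`HasPerDeriv.perAC`), which yield the product
rule, Agmon's inequality `|f|² ≤ ‖f‖ ‖∂ₓf‖` (`PerAC.sq_le`), and all integrations by parts.

For the absorbing set, `(v, v ∂ₓv) = 0` and the Poincaré inequality bring `‖v‖²` below any
`R > ‖h‖² / λ₁²`. Agmon's inequality bounds the forcing by `‖h‖ + R^(1/4) ‖∂ₓv‖^(3/2)`, so that
`‖∂ₓv‖²` decreases at a definite rate wherever it exceeds a number larger than `R³ + 4 ‖h‖ √R`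
(`IsSolution.eventually_norm_dx_sq_le`). The constant `M₀` is larger than this for a suitable `R`
(`exists_radius`); the only property of `β` used is `1 ≤ β`, which the Gagliardo–Nirenberg
inequality forces as `p → 2` (`IsGNConst.one_le`).

For the synchronization, put `f = u - v`. Since `(f, f ∂ₓf) = 0`, the nonlinearity enters the energy
balance of `f` only through `½ ∫ f² ∂ₓv` (`integral_mul_sub_nonlinearity`), hence through a bound for
`‖∂ₓv‖` alone; the part of `M₃` that comes from `K₂` is a nonnegative surplus. The term is absorbed by
the dissipation `‖∂ₓf‖²` and by the damping (`cubic_term_le`): the feedback damps the modes up to `N`,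
and the spectral gap `λ_{N+1}` turns dissipation into damping of the others
(`IsEigenbasis.spectral_gap`). What remains is `d/dt ‖f‖² ≤ -2 ‖f‖²` in integral form.
-/

namespace KdVB

/-! ### Square-integrable functions on the circle -/

/-- Lebesgue measure on the fundamental domain `(0,1]` of the circle. -/
noncomputable abbrev circ : Measure ℝ := volume.restrict (Set.Ioc (0 : ℝ) 1)

instance : IsProbabilityMeasure circ := ⟨by simp [circ]⟩

lemma intervalIntegral_eq (f : ℝ → ℝ) : ∫ x in (0 : ℝ)..1, f x = ∫ x, f x ∂circ :=
  intervalIntegral.integral_of_le zero_le_one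

lemma memLp_coe (f : L2) : MemLp f 2 circ := Lp.memLp f

lemma integrable_mul_of_memLp {f g : ℝ → ℝ} (hf : MemLp f 2 circ) (hg : MemLp g 2 circ) :
    Integrable (fun x => f x * g x) circ := hf.integrable_mul hg

lemma inner_eq (f g : L2) : inner ℝ f g = ∫ x, f x * g x ∂circ := by
  rw [L2.inner_def]
  exact integral_congr_ae (.of_forall fun x => by simp [mul_comm])

lemma norm_sq_eq (f : L2) : ‖f‖ ^ 2 = ∫ x, f x ^ 2 ∂circ := by
  rw [← real_inner_self_eq_norm_sq, inner_eq]
  simp [sq]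

/-- Cauchy–Schwarz for square-integrable functions, with the absolute value inside. -/
lemma integral_abs_mul_le {f g : ℝ → ℝ} (hf : MemLp f 2 circ) (hg : MemLp g 2 circ) :
    ∫ x, |f x * g x| ∂circ ≤ √(∫ x, f x ^ 2 ∂circ) * √(∫ x, g x ^ 2 ∂circ) := by
  have key : ∀ {f : ℝ → ℝ} (hf : MemLp f 2 circ), ‖hf.norm.toLp‖ = √(∫ x, f x ^ 2 ∂circ) := by
    intro f hf
    rw [← Real.sqrt_sq (norm_nonneg hf.norm.toLp), norm_sq_eq]
    congr 1
    refine integral_congr_ae ?_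
    filter_upwards [hf.norm.coeFn_toLp] with x hx
    rw [hx, Real.norm_eq_abs, sq_abs]
  have h := real_inner_le_norm (hf.norm.toLp : L2) hg.norm.toLp
  rw [key hf, key hg, inner_eq] at h
  refine le_trans (le_of_eq (integral_congr_ae ?_)) h
  filter_upwards [hf.norm.coeFn_toLp, hg.norm.coeFn_toLp] with x hx hy
  rw [hx, hy, Real.norm_eq_abs, Real.norm_eq_abs, abs_mul]

lemma abs_integral_mul_le {f g : ℝ → ℝ} (hf : MemLp f 2 circ) (hg : MemLp g 2 circ) :
    |∫ x, f x * g x ∂circ| ≤ √(∫ x, f x ^ 2 ∂circ) * √(∫ x, g x ^ 2 ∂circ) :=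
  abs_integral_le_integral_abs.trans (integral_abs_mul_le hf hg)

/-! ### Fourier coefficients and Parseval's identity -/

/-- The frequency `2πk`. -/
noncomputable def freq (k : ℤ) : ℝ := 2 * Real.pi * k

/-- The cosine coefficient of `f` at the frequency `2πk`. Both signs of `k` are allowed, so that
sums over `k : ℤ` carry no factor `2`. -/
noncomputable def cosCoeff (f : ℝ → ℝ) (k : ℤ) : ℝ := ∫ x, f x * Real.cos (freq k * x) ∂circ

/-- The sine coefficient of `f` at the frequency `2πk`, for `k` of either sign. -/
noncomputable def sinCoeff (f : ℝ → ℝ) (k : ℤ) : ℝ := ∫ x, f x * Real.sin (freq k * x) ∂circ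

lemma integrable_mul_bdd {f φ : ℝ → ℝ} (hf : Integrable f circ) (hφ : Continuous φ)
    (hb : ∀ x, |φ x| ≤ 1) : Integrable (fun x => f x * φ x) circ :=
  hf.mul_bdd (c := 1) hφ.aestronglyMeasurable (.of_forall fun x => by simpa using hb x)

lemma integrable_mul_cos {f : ℝ → ℝ} (hf : Integrable f circ) (k : ℤ) :
    Integrable (fun x => f x * Real.cos (freq k * x)) circ :=
  integrable_mul_bdd hf (by fun_prop) fun _ => Real.abs_cos_le_one _

lemma integrable_mul_sin {f : ℝ → ℝ} (hf : Integrable f circ) (k : ℤ) :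
    Integrable (fun x => f x * Real.sin (freq k * x)) circ :=
  integrable_mul_bdd hf (by fun_prop) fun _ => Real.abs_sin_le_one _

lemma cosCoeff_congr {f g : ℝ → ℝ} (h : f =ᵐ[circ] g) (k : ℤ) : cosCoeff f k = cosCoeff g k :=
  integral_congr_ae (by filter_upwards [h] with x hx; rw [hx])

lemma sinCoeff_congr {f g : ℝ → ℝ} (h : f =ᵐ[circ] g) (k : ℤ) : sinCoeff f k = sinCoeff g k :=
  integral_congr_ae (by filter_upwards [h] with x hx; rw [hx])

lemma cosCoeff_add {f g : ℝ → ℝ} (hf : Integrable f circ) (hg : Integrable g circ) (k : ℤ) :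
    cosCoeff (fun x => f x + g x) k = cosCoeff f k + cosCoeff g k := by
  simp only [cosCoeff, add_mul]
  exact integral_add (integrable_mul_cos hf k) (integrable_mul_cos hg k)

lemma sinCoeff_add {f g : ℝ → ℝ} (hf : Integrable f circ) (hg : Integrable g circ) (k : ℤ) :
    sinCoeff (fun x => f x + g x) k = sinCoeff f k + sinCoeff g k := by
  simp only [sinCoeff, add_mul]
  exact integral_add (integrable_mul_sin hf k) (integrable_mul_sin hg k)

lemma cosCoeff_sub {f g : ℝ → ℝ} (hf : Integrable f circ) (hg : Integrable g circ) (k : ℤ) :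
    cosCoeff (fun x => f x - g x) k = cosCoeff f k - cosCoeff g k := by
  simp only [cosCoeff, sub_mul]
  exact integral_sub (integrable_mul_cos hf k) (integrable_mul_cos hg k)

lemma sinCoeff_sub {f g : ℝ → ℝ} (hf : Integrable f circ) (hg : Integrable g circ) (k : ℤ) :
    sinCoeff (fun x => f x - g x) k = sinCoeff f k - sinCoeff g k := by
  simp only [sinCoeff, sub_mul]
  exact integral_sub (integrable_mul_sin hf k) (integrable_mul_sin hg k)

lemma fourierCoeffOn_ofReal {f : ℝ → ℝ} (hf : Integrable f circ) (k : ℤ) :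
    fourierCoeffOn zero_lt_one (fun x => (f x : ℂ)) k = cosCoeff f k - sinCoeff f k * Complex.I := by
  rw [fourierCoeffOn_eq_integral, intervalIntegral.integral_of_le zero_le_one, cosCoeff, sinCoeff,
    ← integral_complex_ofReal, ← integral_complex_ofReal, ← integral_mul_const, ← integral_sub
      (integrable_mul_cos hf k).ofReal ((integrable_mul_sin hf k).ofReal.mul_const _)]
  simp only [sub_zero, div_one, one_smul]
  refine integral_congr_ae (.of_forall fun x => ?_)
  have h : (2 * Real.pi * Complex.I * (-k : ℤ) * x / ((1 - 0 : ℝ) : ℂ) : ℂ)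
      = (-(freq k * x) : ℂ) * Complex.I := by
    simp [freq]; ring
  simp only [fourier_coe_apply, smul_eq_mul]
  rw [h, Complex.exp_mul_I, Complex.cos_neg, Complex.sin_neg]
  push_cast
  ring

/-- Parseval's identity, in real form. -/
lemma hasSum_coeff_sq {f : ℝ → ℝ} (hf : MemLp f 2 circ) :
    HasSum (fun k => cosCoeff f k ^ 2 + sinCoeff f k ^ 2) (∫ x, f x ^ 2 ∂circ) := by
  have h := hasSum_sq_fourierCoeffOn (f := fun x => (f x : ℂ)) zero_lt_one hf.ofReal
  convert h using 1
  · ext k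
    rw [fourierCoeffOn_ofReal (hf.integrable one_le_two), ← Complex.normSq_eq_norm_sq,
      Complex.normSq_apply]
    simp
    ring
  · simp [intervalIntegral.integral_of_le zero_le_one]

/-- Parseval's identity for two functions, by polarization. -/
lemma hasSum_coeff_mul {f g : ℝ → ℝ} (hf : MemLp f 2 circ) (hg : MemLp g 2 circ) :
    HasSum (fun k => cosCoeff f k * cosCoeff g k + sinCoeff f k * sinCoeff g k)
      (∫ x, f x * g x ∂circ) := by
  have h := ((hasSum_coeff_sq (f := fun x => f x + g x) (hf.add hg)).sub
    ((hasSum_coeff_sq hf).add (hasSum_coeff_sq hg))).mul_left (1 / 2)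
  have hf1 := hf.integrable one_le_two
  have hg1 := hg.integrable one_le_two
  have e1 : ∀ k, cosCoeff f k * cosCoeff g k + sinCoeff f k * sinCoeff g k =
      1 / 2 * (cosCoeff (fun x => f x + g x) k ^ 2 + sinCoeff (fun x => f x + g x) k ^ 2 -
        (cosCoeff f k ^ 2 + sinCoeff f k ^ 2 + (cosCoeff g k ^ 2 + sinCoeff g k ^ 2))) := by
    intro k
    rw [cosCoeff_add hf1 hg1, sinCoeff_add hf1 hg1]
    ring
  have e2 : ∫ x, f x * g x ∂circ =
      1 / 2 * (∫ x, (f x + g x) ^ 2 ∂circ - (∫ x, f x ^ 2 ∂circ + ∫ x, g x ^ 2 ∂circ)) := by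
    have h1 : Integrable (fun x => (f x + g x) ^ 2) circ := (hf.add hg).integrable_sq
    have h2 : Integrable (fun x => f x ^ 2 + g x ^ 2) circ := hf.integrable_sq.add hg.integrable_sq
    rw [← integral_add hf.integrable_sq hg.integrable_sq, ← integral_sub h1 h2,
      ← integral_const_mul]
    exact integral_congr_ae (.of_forall fun x => by ring)
  rw [e2]
  exact h.congr_fun e1

lemma ae_eq_zero_of_coeff {f : ℝ → ℝ} (hf : MemLp f 2 circ)
    (hc : ∀ k, cosCoeff f k = 0) (hs : ∀ k, sinCoeff f k = 0) : f =ᵐ[circ] 0 := by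
  have h := hasSum_coeff_sq hf
  simp only [hc, hs] at h
  have h0 : ∫ x, f x ^ 2 ∂circ = 0 := h.unique (by simp)
  rw [integral_eq_zero_iff_of_nonneg (fun x => sq_nonneg _) hf.integrable_sq] at h0
  filter_upwards [h0] with x hx
  simpa using hx

/-! ### Periodic absolutely continuous functions -/

/-- `f` agrees almost everywhere on `(0,1]` with an absolutely continuous function on `[0,1]` that
takes the same value at both ends, and `f'` is the derivative of that function. -/
def PerAC (f f' : ℝ → ℝ) : Prop :=
  ∃ F : ℝ → ℝ, AbsolutelyContinuousOnInterval F 0 1 ∧ F 0 = F 1 ∧ f =ᵐ[circ] F ∧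
    f' =ᵐ[circ] deriv F

lemma ae_circ_of_ae_uIcc {p : ℝ → Prop} (h : ∀ᵐ x, x ∈ Set.uIcc (0 : ℝ) 1 → p x) :
    ∀ᵐ x ∂circ, p x := by
  rw [ae_restrict_iff' measurableSet_Ioc]
  filter_upwards [h] with x hx hx'
  exact hx (by rw [Set.uIcc_of_le zero_le_one]; exact Set.Ioc_subset_Icc_self hx')

lemma PerAC.mul {f f' g g' : ℝ → ℝ} (hf : PerAC f f') (hg : PerAC g g') :
    PerAC (fun x => f x * g x) (fun x => f' x * g x + f x * g' x) := by
  obtain ⟨F, hF, hF0, hfF, hfF'⟩ := hf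
  obtain ⟨G, hG, hG0, hgG, hgG'⟩ := hg
  refine ⟨fun x => F x * G x, hF.fun_mul hG, by simp [hF0, hG0], ?_, ?_⟩
  · filter_upwards [hfF, hgG] with x h1 h2
    rw [h1, h2]
  · filter_upwards [hfF, hgG, hfF', hgG', ae_circ_of_ae_uIcc hF.ae_differentiableAt,
      ae_circ_of_ae_uIcc hG.ae_differentiableAt] with x h1 h2 h3 h4 h5 h6
    rw [h1, h2, h3, h4]
    exact (h5.hasDerivAt.mul h6.hasDerivAt).deriv.symm

lemma PerAC.integral_eq_zero {f f' : ℝ → ℝ} (hf : PerAC f f') : ∫ x, f' x ∂circ = 0 := by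
  obtain ⟨F, hF, hF0, -, hfF'⟩ := hf
  rw [integral_congr_ae hfF', ← intervalIntegral_eq, hF.integral_deriv_eq_sub, hF0, sub_self]

lemma IsTest.perAC {φ : ℝ → ℝ} (hφ : IsTest φ) : PerAC φ (deriv φ) :=
  ⟨φ, (hφ.1.of_le (by simp)).contDiffOn.absolutelyContinuousOnInterval,
    by simpa using (hφ.2 0).symm, .rfl, .rfl⟩

lemma isTest_cos (k : ℤ) : IsTest fun x => Real.cos (freq k * x) := by
  refine ⟨by fun_prop, fun x => ?_⟩
  have : freq k * (x + 1) = freq k * x + k * (2 * Real.pi) := by simp [freq]; ring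
  simp only [this, Real.cos_add_int_mul_two_pi]

lemma isTest_sin (k : ℤ) : IsTest fun x => Real.sin (freq k * x) := by
  refine ⟨by fun_prop, fun x => ?_⟩
  have : freq k * (x + 1) = freq k * x + k * (2 * Real.pi) := by simp [freq]; ring
  simp only [this, Real.sin_add_int_mul_two_pi]

lemma isTest_one : IsTest fun _ => (1 : ℝ) := ⟨contDiff_const, fun _ => rfl⟩

lemma deriv_cos_freq (a : ℝ) :
    deriv (fun x => Real.cos (a * x)) = fun x => -a * Real.sin (a * x) := by
  ext x
  have := ((hasDerivAt_id x).const_mul a).cos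
  simp at this
  rw [this.deriv]; ring

lemma deriv_sin_freq (a : ℝ) :
    deriv (fun x => Real.sin (a * x)) = fun x => a * Real.cos (a * x) := by
  ext x
  have := ((hasDerivAt_id x).const_mul a).sin
  simp at this
  rw [this.deriv]; ring

lemma HasPerDeriv.cosCoeff_eq {f g : L2} (h : HasPerDeriv f g) (k : ℤ) :
    cosCoeff g k = freq k * sinCoeff f k := by
  have := h _ (isTest_cos k)
  rw [deriv_cos_freq, intervalIntegral_eq, intervalIntegral_eq] at this
  rw [cosCoeff, sinCoeff, ← integral_const_mul, ← neg_eq_iff_eq_neg.mpr this, ← integral_neg]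
  exact integral_congr_ae (.of_forall fun x => by ring)

lemma HasPerDeriv.sinCoeff_eq {f g : L2} (h : HasPerDeriv f g) (k : ℤ) :
    sinCoeff g k = -freq k * cosCoeff f k := by
  have := h _ (isTest_sin k)
  rw [deriv_sin_freq, intervalIntegral_eq, intervalIntegral_eq] at this
  rw [cosCoeff, sinCoeff, ← integral_const_mul, ← neg_eq_iff_eq_neg.mpr this, ← integral_neg]
  exact integral_congr_ae (.of_forall fun x => by ring)

/-- The du Bois-Reymond lemma on the circle: a function with a weak periodic derivative is a
constant plus the primitive of that derivative, because both have the same Fourier coefficients at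
the nonzero frequencies. -/
lemma HasPerDeriv.perAC {f g : L2} (h : HasPerDeriv f g) : PerAC f g := by
  have hgi : IntervalIntegrable g volume 0 1 := by
    rw [intervalIntegrable_iff_integrableOn_Ioc_of_le zero_le_one]
    exact (memLp_coe g).integrable one_le_two
  have hg0 : ∫ x in (0 : ℝ)..1, g x = 0 := by
    simpa using (h _ isTest_one).symm
  set G : ℝ → ℝ := fun x => ∫ t in (0 : ℝ)..x, g t with hG
  have hGac : AbsolutelyContinuousOnInterval G 0 1 :=
    hgi.absolutelyContinuousOnInterval_intervalIntegral (by simp)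
  have hG' : (g : ℝ → ℝ) =ᵐ[circ] deriv G := by
    filter_upwards [ae_circ_of_ae_uIcc hgi.ae_hasDerivAt_integral,
      ae_circ_of_ae_uIcc (.of_forall fun x hx => hx)] with x hx hx'
    exact ((hx 0 (by simp)).deriv).symm
  have hGper : PerAC G g := ⟨G, hGac, by simp [hG, hg0], .rfl, hG'⟩
  have hGb : MemLp G 2 circ := by
    obtain ⟨C, hC⟩ := hGac.exists_bound
    have hm : AEStronglyMeasurable G circ := by
      have := hGac.continuousOn
      rw [Set.uIcc_of_le zero_le_one] at this
      exact (this.mono Set.Ioc_subset_Icc_self).aestronglyMeasurable measurableSet_Ioc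
    exact MemLp.of_bound hm C (ae_circ_of_ae_uIcc (.of_forall hC))
  set c : ℝ := ∫ x, f x - G x ∂circ with hc
  have hfi := (memLp_coe f).integrable one_le_two
  have hGi := hGb.integrable one_le_two
  have hfG : MemLp (fun x => f x - G x) 2 circ := (memLp_coe f).sub hGb
  have hfGi := hfG.integrable one_le_two
  have hgi' := (memLp_coe g).integrable one_le_two
  -- Integration by parts for the primitive `G` against a test function.
  have hparts : ∀ φ, IsTest φ → (∀ x, |φ x| ≤ 1) → ∀ C, (∀ x, |deriv φ x| ≤ C) →
      ∫ x, (f x - G x) * deriv φ x ∂circ = 0 := by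
    intro φ hφ hb C hC
    have hdc : Continuous (deriv φ) := hφ.1.continuous_deriv (by simp)
    have i1 : ∀ {k : ℝ → ℝ}, Integrable k circ → Integrable (fun x => k x * deriv φ x) circ :=
      fun hk => hk.mul_bdd (c := C) hdc.aestronglyMeasurable (.of_forall fun x => by simpa using hC x)
    have h1 := (hGper.mul hφ.perAC).integral_eq_zero
    rw [integral_add (integrable_mul_bdd hgi' hφ.1.continuous hb) (i1 hGi)] at h1
    have h2 := h φ hφ
    rw [intervalIntegral_eq, intervalIntegral_eq] at h2
    simp only [sub_mul]
    rw [integral_sub (i1 hfi) (i1 hGi)]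
    linarith
  have hcos0 : ∀ k : ℤ, k ≠ 0 → cosCoeff (fun x => f x - G x) k = 0 := by
    intro k hk
    have hk' : freq k ≠ 0 := by simp [freq, hk, Real.pi_ne_zero]
    have := hparts _ (isTest_sin k) (fun _ => Real.abs_sin_le_one _) |freq k| (fun x => by
      rw [deriv_sin_freq, abs_mul]
      exact mul_le_of_le_one_right (abs_nonneg _) (Real.abs_cos_le_one _))
    rw [deriv_sin_freq] at this
    simp only [mul_left_comm _ (freq k), integral_const_mul] at this
    exact (mul_eq_zero.mp this).resolve_left hk'
  have hsin0 : ∀ k : ℤ, k ≠ 0 → sinCoeff (fun x => f x - G x) k = 0 := by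
    intro k hk
    have hk' : -freq k ≠ 0 := by simp [freq, hk, Real.pi_ne_zero]
    have := hparts _ (isTest_cos k) (fun _ => Real.abs_cos_le_one _) |freq k| (fun x => by
      rw [deriv_cos_freq, abs_mul, abs_neg]
      exact mul_le_of_le_one_right (abs_nonneg _) (Real.abs_sin_le_one _))
    rw [deriv_cos_freq] at this
    simp only [mul_left_comm _ (-freq k), integral_const_mul] at this
    exact (mul_eq_zero.mp this).resolve_left hk'
  have hconst : ∀ k : ℤ, k ≠ 0 → cosCoeff (fun _ => c) k = 0 ∧ sinCoeff (fun _ => c) k = 0 := by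
    intro k hk
    have hk' : freq k ≠ 0 := by simp [freq, hk, Real.pi_ne_zero]
    have h1 := (isTest_sin k).perAC.integral_eq_zero
    have h2 := (isTest_cos k).perAC.integral_eq_zero
    rw [deriv_sin_freq, integral_const_mul] at h1
    rw [deriv_cos_freq, integral_const_mul] at h2
    simp only [cosCoeff, sinCoeff, integral_const_mul]
    simp only [neg_mul, neg_eq_zero, mul_eq_zero, hk', false_or] at h1 h2
    simp [h1, h2]
  have hz := ae_eq_zero_of_coeff (f := fun x => (f x - G x) - c) (hfG.sub (memLp_const c))
    (fun k => by
      rw [cosCoeff_sub hfGi (integrable_const c)]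
      rcases eq_or_ne k 0 with rfl | hk
      · simp [cosCoeff, freq, hc]
      · rw [hcos0 k hk, (hconst k hk).1, sub_zero])
    (fun k => by
      rw [sinCoeff_sub hfGi (integrable_const c)]
      rcases eq_or_ne k 0 with rfl | hk
      · simp [sinCoeff, freq]
      · rw [hsin0 k hk, (hconst k hk).2, sub_zero])
  have hcac : AbsolutelyContinuousOnInterval (fun _ : ℝ => c) 0 1 :=
    (contDiffOn_const).absolutelyContinuousOnInterval
  refine ⟨fun x => G x + c, hGac.add hcac, by simp [hG, hg0], ?_, ?_⟩
  · filter_upwards [hz] with x hx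
    simp only [Pi.zero_apply] at hx
    linarith
  · filter_upwards [hG'] with x hx
    rw [hx]
    simp

/-- An absolutely continuous periodic function oscillates by at most half of the integral of the
absolute value of its derivative: two arcs of the circle join any two points. -/
lemma two_mul_abs_sub_le {P : ℝ → ℝ} (hP : AbsolutelyContinuousOnInterval P 0 1) (h01 : P 0 = P 1)
    {a b : ℝ} (ha : 0 ≤ a) (hab : a ≤ b) (hb : b ≤ 1) :
    2 * |P b - P a| ≤ ∫ x in (0 : ℝ)..1, |deriv P x| := by
  have hi := hP.intervalIntegrable_deriv
  have sub : ∀ {s t : ℝ}, 0 ≤ s → s ≤ t → t ≤ 1 → Set.uIcc s t ⊆ Set.uIcc (0 : ℝ) 1 := by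
    intro s t hs hst ht
    rw [Set.uIcc_of_le hst, Set.uIcc_of_le zero_le_one]
    exact Set.Icc_subset_Icc hs ht
  have bd : ∀ {s t : ℝ}, 0 ≤ s → s ≤ t → t ≤ 1 → |P t - P s| ≤ ∫ x in s..t, |deriv P x| := by
    intro s t hs hst ht
    rw [← (hP.mono (sub hs hst ht)).integral_deriv_eq_sub]
    exact intervalIntegral.abs_integral_le_integral_abs hst
  have ii : ∀ {s t : ℝ}, 0 ≤ s → s ≤ t → t ≤ 1 →
      IntervalIntegrable (fun x => |deriv P x|) volume s t :=
    fun hs hst ht => (hi.mono_set (sub hs hst ht)).abs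
  rw [← intervalIntegral.integral_add_adjacent_intervals (ii le_rfl ha (hab.trans hb))
      (ii ha (hab.trans hb) le_rfl),
    ← intervalIntegral.integral_add_adjacent_intervals (ii ha hab hb) (ii (ha.trans hab) hb le_rfl)]
  have h1 := bd le_rfl ha (hab.trans hb)
  have h2 := bd ha hab hb
  have h3 := bd (ha.trans hab) hb le_rfl
  have h4 : |P b - P a| ≤ |P a - P 0| + |P 1 - P b| := by
    rw [h01, abs_sub_comm (P b), show P a - P b = (P a - P 1) + (P 1 - P b) by ring]
    exact abs_add_le _ _
  linarith

/-- Agmon's inequality on the circle, with the constant `1`. -/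
lemma PerAC.sq_le {f f' : ℝ → ℝ} (h : PerAC f f') (hf : MemLp f 2 circ) (hf' : MemLp f' 2 circ)
    (hmean : ∫ x, f x ∂circ = 0) :
    ∀ᵐ x ∂circ, f x ^ 2 ≤ √(∫ x, f x ^ 2 ∂circ) * √(∫ x, f' x ^ 2 ∂circ) := by
  obtain ⟨F, hF, hF0, hfF, hfF'⟩ := h
  have hcont := hF.continuousOn
  obtain ⟨x₀, hx₀, hzero⟩ := exists_eq_interval_average (f := F) (zero_ne_one) hcont
  rw [interval_average_eq, intervalIntegral_eq, ← integral_congr_ae hfF, hmean, smul_zero] at hzero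
  rw [Set.uIoo_of_le zero_le_one] at hx₀
  have hP : AbsolutelyContinuousOnInterval (fun x => F x * F x) 0 1 := hF.fun_mul hF
  have hint : ∫ x in (0 : ℝ)..1, |deriv (fun x => F x * F x) x| = 2 * ∫ x, |f x * f' x| ∂circ := by
    rw [intervalIntegral_eq, ← integral_const_mul]
    refine integral_congr_ae ?_
    filter_upwards [hfF, hfF', ae_circ_of_ae_uIcc hF.ae_differentiableAt] with x h1 h2 h3
    rw [h1, h2, (h3.hasDerivAt.fun_mul h3.hasDerivAt).deriv,
      show deriv F x * F x + F x * deriv F x = 2 * (F x * deriv F x) by ring, abs_mul, abs_two]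
  have hall : ∀ x ∈ Set.Icc (0 : ℝ) 1, F x * F x ≤ ∫ x, |f x * f' x| ∂circ := by
    intro x hx
    rcases le_total x₀ x with hle | hle
    · have := two_mul_abs_sub_le hP (by simp [hF0]) hx₀.1.le hle hx.2
      rw [hint] at this
      simp only [hzero, mul_zero, sub_zero] at this
      linarith [le_abs_self (F x * F x)]
    · have := two_mul_abs_sub_le hP (by simp [hF0]) hx.1 hle hx₀.2.le
      rw [hint] at this
      simp only [hzero, mul_zero, zero_sub, abs_neg] at this
      linarith [le_abs_self (F x * F x)]
  filter_upwards [hfF, ae_restrict_mem measurableSet_Ioc] with x h1 h2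
  rw [h1, sq]
  exact (hall x ⟨h2.1.le, h2.2⟩).trans (integral_abs_mul_le hf hf')

/-! ### Weak derivatives and the Poincaré inequality -/

lemma hasPerDeriv_dx {f : L2} (h : ∃ g, HasPerDeriv f g) : HasPerDeriv f (dx f) := by
  rw [dx, dif_pos h]
  exact h.choose_spec

lemma MemHdot.hasPerDeriv {m : ℕ} {f : L2} (h : MemHdot m f) (hm : 1 ≤ m) :
    HasPerDeriv f (dx f) := hasPerDeriv_dx (h.1 0 hm)

lemma MemHdot.hasPerDeriv_dx {f : L2} (h : MemHdot 2 f) : HasPerDeriv (dx f) (dx (dx f)) :=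
  KdVB.hasPerDeriv_dx (h.1 1 one_lt_two)

lemma MemHdot.integral_eq_zero {m : ℕ} {f : L2} (h : MemHdot m f) : ∫ x, f x ∂circ = 0 := by
  rw [← intervalIntegral_eq]
  exact h.2

lemma integrable_mul_of_continuous {φ : ℝ → ℝ} (hφ : Continuous φ) {f : ℝ → ℝ} (hf : Integrable f circ) :
    Integrable (fun x => f x * φ x) circ := by
  obtain ⟨C, hC⟩ := (isCompact_Icc (a := (0 : ℝ)) (b := 1)).exists_bound_of_continuousOn
    hφ.continuousOn
  refine hf.mul_bdd (c := C) hφ.aestronglyMeasurable ?_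
  filter_upwards [ae_restrict_mem measurableSet_Ioc] with x hx
  exact hC x ⟨hx.1.le, hx.2⟩

lemma HasPerDeriv.sub {f f' g g' : L2} (hf : HasPerDeriv f f') (hg : HasPerDeriv g g') :
    HasPerDeriv (f - g) (f' - g') := by
  intro φ hφ
  have hc : Continuous φ := hφ.1.continuous
  have hd : Continuous (deriv φ) := hφ.1.continuous_deriv (by simp)
  have h1 := hf φ hφ
  have h2 := hg φ hφ
  rw [intervalIntegral_eq, intervalIntegral_eq] at h1 h2 ⊢
  have i : ∀ k : L2, Integrable k circ := fun k => (memLp_coe k).integrable one_le_two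
  have key : ∀ (a b : L2) {ψ : ℝ → ℝ}, Continuous ψ →
      ∫ x, (a - b : L2) x * ψ x ∂circ = ∫ x, a x * ψ x ∂circ - ∫ x, b x * ψ x ∂circ := by
    intro a b ψ hψ
    rw [← integral_sub (integrable_mul_of_continuous hψ (i a)) (integrable_mul_of_continuous hψ (i b))]
    refine integral_congr_ae ?_
    filter_upwards [Lp.coeFn_sub a b] with x hx
    rw [hx, Pi.sub_apply, sub_mul]
  rw [key _ _ hc, key _ _ hd, h1, h2]
  ring

lemma HasPerDeriv.inner_eq_neg {f f' g g' : L2} (hf : HasPerDeriv f f') (hg : HasPerDeriv g g') :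
    (inner ℝ f' g : ℝ) = -inner ℝ f g' := by
  have h := (hf.perAC.mul hg.perAC).integral_eq_zero
  rw [integral_add (integrable_mul_of_memLp (memLp_coe _) (memLp_coe _))
    (integrable_mul_of_memLp (memLp_coe _) (memLp_coe _)), ← inner_eq, ← inner_eq] at h
  linarith

lemma HasPerDeriv.hasSum {f d : L2} (h : HasPerDeriv f d) :
    HasSum (fun k => freq k ^ 2 * (cosCoeff f k ^ 2 + sinCoeff f k ^ 2)) (‖d‖ ^ 2) := by
  rw [norm_sq_eq]
  refine (hasSum_coeff_sq (memLp_coe d)).congr_fun fun k => ?_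
  rw [h.cosCoeff_eq, h.sinCoeff_eq]
  ring

/-- The Poincaré inequality; the best constant is `4π² > 36`. -/
lemma HasPerDeriv.poincare {f d : L2} (h : HasPerDeriv f d) (hf : ∫ x, f x ∂circ = 0) :
    36 * ‖f‖ ^ 2 ≤ ‖d‖ ^ 2 := by
  rw [norm_sq_eq f]
  refine hasSum_le (fun k => ?_) ((hasSum_coeff_sq (memLp_coe f)).mul_left 36) h.hasSum
  rcases eq_or_ne k 0 with rfl | hk
  · simp [cosCoeff, sinCoeff, freq, hf]
  · refine mul_le_mul_of_nonneg_right ?_ (by positivity)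
    have h1 : (1 : ℝ) ≤ (k : ℝ) ^ 2 := by
      have : (1 : ℤ) ≤ k ^ 2 := by have := sq_pos_of_ne_zero hk; omega
      exact_mod_cast this
    have h2 := Real.pi_gt_three
    have h3 : (9 : ℝ) ≤ Real.pi ^ 2 := by nlinarith
    have : freq k ^ 2 = 4 * (Real.pi ^ 2 * (k : ℝ) ^ 2) := by rw [freq]; ring
    rw [this]
    nlinarith

/-! ### The eigenbasis -/

section Eigenbasis

variable {w : ℕ → L2} {lam : ℕ → ℝ}

lemma IsEigenbasis.inner_dx (hw : IsEigenbasis w lam) {f d : L2} (hf : HasPerDeriv f d) {k : ℕ}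
    (hk : 1 ≤ k) : (inner ℝ d (dx (w k)) : ℝ) = lam k * inner ℝ f (w k) := by
  rw [hf.inner_eq_neg (hw.mem k hk).hasPerDeriv_dx, ← inner_neg_right, hw.eigen k hk,
    inner_smul_right]

lemma IsEigenbasis.inner_dx_dx (hw : IsEigenbasis w lam) {j k : ℕ} (hj : 1 ≤ j) (hk : 1 ≤ k) :
    (inner ℝ (dx (w j)) (dx (w k)) : ℝ) = if j = k then lam k else 0 := by
  rw [hw.inner_dx ((hw.mem j hj).hasPerDeriv one_le_two) hk, hw.orthonormal j k hj hk]
  simp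

lemma IsEigenbasis.norm_eq_one (hw : IsEigenbasis w lam) {k : ℕ} (hk : 1 ≤ k) : ‖w k‖ = 1 := by
  have := hw.orthonormal k k hk hk
  rw [if_pos rfl, real_inner_self_eq_norm_sq] at this
  nlinarith [norm_nonneg (w k)]

lemma IsEigenbasis.le_lam (hw : IsEigenbasis w lam) {k : ℕ} (hk : 1 ≤ k) : 36 ≤ lam k := by
  have h1 := ((hw.mem k hk).hasPerDeriv one_le_two).poincare (hw.mem k hk).integral_eq_zero
  have h2 := hw.inner_dx_dx hk hk
  rw [if_pos rfl, real_inner_self_eq_norm_sq] at h2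
  rw [hw.norm_eq_one hk, h2] at h1
  linarith

lemma meanZero_iff (f : L2) : MeanZero f ↔ (inner ℝ f ((memLp_const (1 : ℝ)).toLp : L2) : ℝ) = 0 := by
  have : (inner ℝ f ((memLp_const (1 : ℝ)).toLp : L2) : ℝ) = ∫ x, f x ∂circ := by
    rw [inner_eq]
    refine integral_congr_ae ?_
    filter_upwards [(memLp_const (1 : ℝ) : MemLp (fun _ => (1 : ℝ)) 2 circ).coeFn_toLp] with x hx
    rw [hx, mul_one]
  rw [this, MeanZero, intervalIntegral_eq]

/-- Parseval's identity for the eigenbasis. -/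
lemma IsEigenbasis.hasSum_inner_sq (hw : IsEigenbasis w lam) {f : L2} (hf : MeanZero f) :
    HasSum (fun k : ℕ => (inner ℝ f (w (k + 1)) : ℝ) ^ 2) (‖f‖ ^ 2) := by
  set one : L2 := (memLp_const (1 : ℝ)).toLp
  set E : Submodule ℝ L2 := (Submodule.span ℝ {one})ᗮ with hE
  have memE : ∀ g : L2, g ∈ E ↔ MeanZero g := fun g => by
    rw [meanZero_iff, hE, Submodule.mem_orthogonal_singleton_iff_inner_left]
  let e : ℕ → E := fun k => ⟨w (k + 1), (memE _).2 (hw.mem (k + 1) (by omega)).2⟩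
  have he : Orthonormal ℝ e := by
    rw [orthonormal_iff_ite]
    intro i j
    simpa [e] using hw.orthonormal (i + 1) (j + 1) (by omega) (by omega)
  have hspan : (Submodule.span ℝ (Set.range e))ᗮ = ⊥ := by
    rw [eq_bot_iff]
    intro g hg
    rw [Submodule.mem_orthogonal] at hg
    have : (g : L2) = 0 := by
      refine hw.complete g ((memE _).1 g.2) fun k hk => ?_
      have := hg (e (k - 1)) (Submodule.subset_span ⟨_, rfl⟩)
      rw [real_inner_comm, Submodule.coe_inner] at this
      simpa [e, Nat.sub_add_cancel hk] using this
    simpa using this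
  have := (HilbertBasis.mkOfOrthogonalEqBot he hspan).hasSum_inner_mul_inner
    ⟨f, (memE f).2 hf⟩ ⟨f, (memE f).2 hf⟩
  rw [HilbertBasis.coe_mkOfOrthogonalEqBot] at this
  simp only [Submodule.coe_inner, e, real_inner_self_eq_norm_sq] at this
  refine this.congr_fun fun k => ?_
  rw [sq, real_inner_comm f]

/-- Bessel's inequality for the orthogonal family `∂ₓ wₖ`. -/
lemma IsEigenbasis.sum_lam_le (hw : IsEigenbasis w lam) {f d : L2} (hf : HasPerDeriv f d)
    (s : Finset ℕ) :
    ∑ k ∈ s, lam (k + 1) * (inner ℝ f (w (k + 1)) : ℝ) ^ 2 ≤ ‖d‖ ^ 2 := by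
  set c : ℕ → ℝ := fun k => inner ℝ f (w (k + 1))
  set S : L2 := ∑ k ∈ s, c k • dx (w (k + 1))
  have h1 : (inner ℝ d S : ℝ) = ∑ k ∈ s, lam (k + 1) * c k ^ 2 := by
    rw [inner_sum]
    refine Finset.sum_congr rfl fun k _ => ?_
    rw [inner_smul_right, hw.inner_dx hf (by omega)]
    ring
  have h2 : (inner ℝ S S : ℝ) = ∑ k ∈ s, lam (k + 1) * c k ^ 2 := by
    rw [inner_sum]
    refine Finset.sum_congr rfl fun k hk => ?_
    rw [inner_smul_right, sum_inner, Finset.sum_eq_single_of_mem k hk]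
    · rw [real_inner_smul_left, hw.inner_dx_dx (by omega) (by omega), if_pos rfl]
      ring
    · intro j _ hjk
      rw [real_inner_smul_left, hw.inner_dx_dx (by omega) (by omega), if_neg (by omega), mul_zero]
  have h3 := norm_sub_sq_real d S
  rw [h1, ← real_inner_self_eq_norm_sq S, h2] at h3
  nlinarith [sq_nonneg ‖d - S‖]

/-- The Poincaré inequality on the orthogonal complement of `w₁, …, w_N`. -/
lemma IsEigenbasis.spectral_gap (hw : IsEigenbasis w lam) {f d : L2} (hf : HasPerDeriv f d)
    (h0 : MeanZero f) (N : ℕ) :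
    lam (N + 1) * (‖f‖ ^ 2 - ∑ k ∈ Finset.Icc 1 N, (inner ℝ f (w k) : ℝ) ^ 2) ≤ ‖d‖ ^ 2 := by
  have hs := hw.hasSum_inner_sq h0
  have hsum : ∑ k ∈ Finset.Icc 1 N, (inner ℝ f (w k) : ℝ) ^ 2 =
      ∑ k ∈ Finset.range N, (inner ℝ f (w (k + 1)) : ℝ) ^ 2 := by
    rw [Finset.range_eq_Ico, Finset.sum_Ico_add' (fun k => (inner ℝ f (w k) : ℝ) ^ 2) 0 N 1]
    rfl
  rw [hsum]
  refine le_of_tendsto ((hs.tendsto_sum_nat.sub_const _).const_mul _) ?_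
  filter_upwards [eventually_ge_atTop N] with n hn
  rw [← Finset.sum_range_add_sum_Ico _ hn, add_sub_cancel_left, Finset.mul_sum]
  refine le_trans (Finset.sum_le_sum fun k hk => ?_) (hw.sum_lam_le hf (Finset.Ico N n))
  refine mul_le_mul_of_nonneg_right (hw.mono _ _ (by omega) ?_) (sq_nonneg _)
  have := (Finset.mem_Ico.1 hk).1
  omega

/-- Letting `p → 2` in the Gagliardo–Nirenberg inequality for an eigenfunction gives `1 ≤ β`. -/
lemma IsGNConst.one_le {β : ℝ} (hβ : IsGNConst β) (hw : IsEigenbasis w lam) : 1 ≤ β := by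
  have hm : MemHdot 1 (w 1) :=
    ⟨fun i hi => (hw.mem 1 le_rfl).1 i (by omega), (hw.mem 1 le_rfl).2⟩
  have hn := hw.norm_eq_one le_rfl
  set A := ‖dx (w 1)‖ with hA
  have hApos : 0 < A := by
    have := ((hw.mem 1 le_rfl).hasPerDeriv one_le_two).poincare hm.integral_eq_zero
    rw [hn] at this
    by_contra hcon
    have h0 : A = 0 := le_antisymm (not_lt.1 hcon) (norm_nonneg _)
    rw [← hA, h0] at this
    norm_num at this
  have key : ∀ p : ℝ, 2 < p → 1 ≤ β * A ^ (1 / 2 - 1 / p) := by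
    intro p hp
    have hp1 : 1 / p ≤ 1 / 2 := one_div_le_one_div_of_le two_pos hp.le
    have hp0 : 0 < 1 / p := by positivity
    have h := hβ p (1 / 2 - 1 / p) 0 1 hp (.inl rfl) (by simp) (by simp; simpa using hp1)
      (by linarith) (w 1) hm
    have h2 : eLpNorm (w 1) 2 circ ≤ eLpNorm (w 1) (ENNReal.ofReal p) circ := by
      refine eLpNorm_le_eLpNorm_of_exponent_le ?_ (Lp.aestronglyMeasurable _)
      rw [← ENNReal.ofReal_ofNat]
      exact ENNReal.ofReal_le_ofReal hp.le
    have h3 : ENNReal.ofReal ‖w 1‖ = eLpNorm (w 1) 2 circ := by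
      rw [Lp.norm_def, ENNReal.ofReal_toReal (Lp.eLpNorm_ne_top _)]
    rw [← h3, hn] at h2
    have h4 := h2.trans h
    rw [hn, Real.one_rpow, mul_one] at h4
    by_contra hcon
    exact absurd h4 (not_le.2 ((ENNReal.ofReal_lt_ofReal_iff one_pos).2 (not_le.1 hcon)))
  have hlim : Tendsto (fun p : ℝ => β * A ^ (1 / 2 - 1 / p)) (𝓝[>] 2) (𝓝 (β * 1)) := by
    refine Tendsto.const_mul β ?_
    have : ContinuousAt (fun p : ℝ => A ^ (1 / 2 - 1 / p)) 2 := by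
      refine ContinuousAt.rpow continuousAt_const ?_ (.inl hApos.ne')
      exact continuousAt_const.sub (continuousAt_const.div continuousAt_id two_ne_zero)
    have h := this.tendsto.mono_left (nhdsWithin_le_nhds (s := Set.Ioi 2))
    simpa using h
  have := ge_of_tendsto hlim (by filter_upwards [self_mem_nhdsWithin] with p hp using key p hp)
  simpa using this

end Eigenbasis

/-! ### Integral inequalities on the half-line -/

/-- A nonnegative function that decreases at a rate of at least `c` as long as it is at least `Y`
ends up below `Y`. -/
lemma eventually_le_of_sub_le_integral {y r : ℝ → ℝ} {T Y c : ℝ} (hc : 0 < c)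
    (hy : ContinuousOn y (Set.Ici T)) (hr : ContinuousOn r (Set.Ici T)) (h0 : ∀ t, T ≤ t → 0 ≤ y t)
    (hint : ∀ s t, T ≤ s → s ≤ t → y t - y s ≤ ∫ τ in s..t, r τ)
    (hneg : ∀ t, T ≤ t → Y ≤ y t → r t ≤ -c) : ∀ᶠ t in atTop, y t ≤ Y := by
  have key : ∀ s t, T ≤ s → s ≤ t → (∀ τ ∈ Set.Icc s t, Y ≤ y τ) → y t - y s ≤ -c * (t - s) := by
    intro s t hs hst hY
    refine (hint s t hs hst).trans ?_
    have hii : IntervalIntegrable r volume s t := by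
      refine (hr.mono ?_).intervalIntegrable
      rw [Set.uIcc_of_le hst]
      exact fun τ hτ => hs.trans hτ.1
    refine (intervalIntegral.integral_mono_on hst hii intervalIntegrable_const
      fun τ hτ => hneg τ (hs.trans hτ.1) (hY τ hτ)).trans ?_
    rw [intervalIntegral.integral_const, smul_eq_mul, mul_comm]
  obtain ⟨s, hs, hsY⟩ : ∃ s, T ≤ s ∧ y s ≤ Y := by
    by_contra! hcon
    have hyT := h0 T le_rfl
    have ht : T ≤ T + (y T + 1) / c := le_add_of_nonneg_right (by positivity)
    have h1 := key T (T + (y T + 1) / c) le_rfl ht fun τ hτ => (hcon τ hτ.1).le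
    have h2 := h0 _ ht
    have h3 : -c * (T + (y T + 1) / c - T) = -(y T + 1) := by field_simp; ring
    linarith
  filter_upwards [eventually_ge_atTop s] with t hst
  by_contra! hcon
  -- The last time before `t` at which `y ≤ Y`.
  set A : Set ℝ := {τ ∈ Set.Icc s t | y τ ≤ Y} with hA
  have hyc : ContinuousOn y (Set.Icc s t) := hy.mono fun τ hτ => hs.trans hτ.1
  have hAc : IsCompact A :=
    isCompact_Icc.of_isClosed_subset (hyc.preimage_isClosed_of_isClosed isClosed_Icc isClosed_Iic)
      fun τ hτ => hτ.1
  obtain ⟨σ, hσ, hmax⟩ := hAc.exists_isGreatest ⟨s, ⟨le_rfl, hst⟩, hsY⟩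
  have hσt : σ < t := lt_of_le_of_ne hσ.1.2 fun h => by rw [← h] at hcon; exact hcon.not_ge hσ.2
  have hgt : ∀ τ ∈ Set.Ioc σ t, Y < y τ := fun τ hτ => by
    by_contra! hle
    exact hτ.1.not_ge (hmax ⟨⟨hσ.1.1.trans hτ.1.le, hτ.2⟩, hle⟩)
  have hσY : Y ≤ y σ := by
    have h1 : Tendsto y (𝓝[Set.Ioc σ t] σ) (𝓝 (y σ)) :=
      (hyc σ hσ.1).mono_left (nhdsWithin_mono _ fun τ hτ => ⟨hσ.1.1.trans hτ.1.le, hτ.2⟩)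
    have : (𝓝[Set.Ioc σ t] σ).NeBot := by
      rw [nhdsWithin_Ioc_eq_nhdsGT hσt]; infer_instance
    exact ge_of_tendsto h1 (by filter_upwards [self_mem_nhdsWithin] with τ hτ using (hgt τ hτ).le)
  have h1 := key σ t (hs.trans hσ.1.1) hσt.le fun τ hτ => by
    rcases eq_or_lt_of_le hτ.1 with h | h
    · rwa [← h]
    · exact (hgt τ ⟨h, hτ.2⟩).le
  have h2 : y σ ≤ Y := hσ.2
  nlinarith

/-- Exponential decay from `y' ≤ -2y` in integral form. -/
lemma le_exp_mul_of_sub_le_integral {y : ℝ → ℝ} {T : ℝ} (hy : ContinuousOn y (Set.Ici T))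
    (hint : ∀ s t, T ≤ s → s ≤ t → y t - y s ≤ ∫ τ in s..t, -2 * y τ) {t : ℝ} (ht : T ≤ t) :
    y t ≤ Real.exp (-2 * (t - T)) * y T := by
  have hyc : ContinuousOn y (Set.Icc T t) := hy.mono fun τ hτ => hτ.1
  have h := le_gronwallBound_of_liminf_deriv_right_le (f := y) (f' := fun x => -2 * y x)
    (δ := y T) (K := -2) (ε := 0) hyc ?_ le_rfl (fun x _ => by simp) t ⟨ht, le_rfl⟩
  · rwa [gronwallBound_ε0, mul_comm] at h
  intro x hx ρ hρ
  refine Eventually.frequently ?_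
  have hc : ContinuousOn (fun τ => -2 * y τ) (Set.Ici T) := continuousOn_const.mul hy
  have hd : HasDerivWithinAt (fun z => ∫ τ in x..z, -2 * y τ) (-2 * y x) (Set.Ioi x) x := by
    refine (intervalIntegral.integral_hasDerivWithinAt_right (s := Set.Ici x) (t := Set.Ioi x)
      (by simp) ?_ ?_).mono Set.Ioi_subset_Ici_self
    · exact ⟨Set.Ioi x, self_mem_nhdsWithin, (hc.mono fun τ hτ =>
        hx.1.trans (le_of_lt hτ)).aestronglyMeasurable measurableSet_Ioi⟩
    · exact (hc x hx.1).mono fun τ hτ => hx.1.trans (le_of_lt hτ)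
  rw [hasDerivWithinAt_iff_tendsto_slope' (by simp)] at hd
  filter_upwards [hd.eventually_lt_const hρ, self_mem_nhdsWithin] with z hz hxz
  rw [slope_def_field, intervalIntegral.integral_same, sub_zero] at hz
  refine lt_of_le_of_lt ?_ hz
  rw [div_eq_inv_mul]
  exact mul_le_mul_of_nonneg_left (hint x z hx.1 (le_of_lt hxz))
    (inv_nonneg.2 (sub_nonneg.2 (le_of_lt hxz)))

/-- Passage to the limit in a family of integral inequalities, when the integrands converge to
something below a continuous function `r`. -/
lemma sub_le_integral_of_tendsto {Y q : Finset ℤ → ℝ → ℝ} {y q₀ r : ℝ → ℝ} {s t C : ℝ} (hst : s ≤ t)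
    (hq : ∀ A, ContinuousOn (q A) (Set.Icc s t)) (hr : ContinuousOn r (Set.Icc s t))
    (hC : ∀ A, ∀ τ ∈ Set.Icc s t, |q A τ| ≤ C)
    (hlim : ∀ τ ∈ Set.Icc s t, Tendsto (fun A => q A τ) atTop (𝓝 (q₀ τ)))
    (hle : ∀ τ ∈ Set.Icc s t, q₀ τ ≤ r τ)
    (hYs : Tendsto (fun A => Y A s) atTop (𝓝 (y s)))
    (hYt : Tendsto (fun A => Y A t) atTop (𝓝 (y t)))
    (hint : ∀ A, Y A t - Y A s ≤ ∫ τ in s..t, q A τ) : y t - y s ≤ ∫ τ in s..t, r τ := by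
  have hu : Set.uIcc s t = Set.Icc s t := Set.uIcc_of_le hst
  have sub : ∀ τ, τ ∈ Set.uIoc s t → τ ∈ Set.Icc s t := fun τ hτ => by
    rw [Set.uIoc_of_le hst] at hτ; exact Set.Ioc_subset_Icc_self hτ
  -- Replacing `q A` by `max (q A) r` makes the limit continuous.
  have hm : ∀ A, ContinuousOn (fun τ => max (q A τ) (r τ)) (Set.Icc s t) := fun A => (hq A).sup hr
  have ii : ∀ {f : ℝ → ℝ}, ContinuousOn f (Set.Icc s t) → IntervalIntegrable f volume s t :=
    fun hf => ContinuousOn.intervalIntegrable (by rwa [hu])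
  have hconv : Tendsto (fun A => ∫ τ in s..t, max (q A τ) (r τ)) atTop (𝓝 (∫ τ in s..t, r τ)) := by
    refine intervalIntegral.tendsto_integral_filter_of_dominated_convergence
      (fun τ => C + |r τ|) (.of_forall fun A => ?_) (.of_forall fun A => .of_forall fun τ hτ => ?_)
      (ii (continuousOn_const.add hr.abs)) (.of_forall fun τ hτ => ?_)
    · exact ((hm A).mono sub).aestronglyMeasurable measurableSet_uIoc
    · have h1 := hC A τ (sub τ hτ)
      rw [Real.norm_eq_abs]
      exact abs_max_le_max_abs_abs.trans (max_le (h1.trans (le_add_of_nonneg_right (abs_nonneg _)))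
        (le_add_of_nonneg_left ((abs_nonneg _).trans h1)))
    · have := (hlim τ (sub τ hτ)).max (tendsto_const_nhds (x := r τ))
      rwa [max_eq_right (hle τ (sub τ hτ))] at this
  refine le_of_tendsto_of_tendsto' (hYt.sub hYs) hconv fun A => (hint A).trans ?_
  exact intervalIntegral.integral_mono_on hst (ii (hq A)) (ii (hm A)) fun τ _ => le_max_left _ _

lemma hasDerivAt_of_sub_eq_integral {p a : ℝ → ℝ} (ha : ContinuousOn a (Set.Ici 0))
    (hp : ∀ t, 0 ≤ t → p t - p 0 = ∫ s in (0 : ℝ)..t, a s) {t : ℝ} (ht : 0 < t) :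
    HasDerivAt p (a t) t := by
  have hd : HasDerivAt (fun t => ∫ s in (0 : ℝ)..t, a s) (a t) t := by
    refine intervalIntegral.integral_hasDerivAt_right ?_ ?_ (ha.continuousAt (Ici_mem_nhds ht))
    · refine (ha.mono ?_).intervalIntegrable
      rw [Set.uIcc_of_le ht.le]
      exact fun τ hτ => hτ.1
    · exact ⟨Set.Ici 0, Ici_mem_nhds ht, ha.aestronglyMeasurable measurableSet_Ici⟩
  refine (hd.const_add (p 0)).congr_of_eventuallyEq ?_
  filter_upwards [Ici_mem_nhds ht] with s hs
  rw [← hp s hs]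
  ring

lemma sq_add_sq_sub_eq_integral {p q a b : ℝ → ℝ} (hpc : ContinuousOn p (Set.Ici 0))
    (hqc : ContinuousOn q (Set.Ici 0)) (ha : ContinuousOn a (Set.Ici 0))
    (hb : ContinuousOn b (Set.Ici 0)) (hp : ∀ t, 0 ≤ t → p t - p 0 = ∫ s in (0 : ℝ)..t, a s)
    (hq : ∀ t, 0 ≤ t → q t - q 0 = ∫ s in (0 : ℝ)..t, b s) {s t : ℝ} (hs : 0 ≤ s) (hst : s ≤ t) :
    (p t ^ 2 + q t ^ 2) - (p s ^ 2 + q s ^ 2) = ∫ τ in s..t, 2 * (p τ * a τ + q τ * b τ) := by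
  have sub : Set.Icc s t ⊆ Set.Ici 0 := fun τ hτ => hs.trans hτ.1
  symm
  refine intervalIntegral.integral_eq_sub_of_hasDerivAt_of_le
    (f := fun τ => p τ ^ 2 + q τ ^ 2) hst (((hpc.pow 2).add (hqc.pow 2)).mono sub)
    (fun τ hτ => ?_) ?_
  · have hτ0 : 0 < τ := hs.trans_lt hτ.1
    refine (((hasDerivAt_of_sub_eq_integral ha hp hτ0).fun_pow 2).fun_add
      ((hasDerivAt_of_sub_eq_integral hb hq hτ0).fun_pow 2)).congr_deriv ?_
    push_cast
    ring
  · refine ContinuousOn.intervalIntegrable ?_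
    rw [Set.uIcc_of_le hst]
    exact (continuousOn_const.mul ((hpc.mul ha).add (hqc.mul hb))).mono sub

/-! ### The equation for the Fourier modes -/

/-- The curve `z`, with weak space derivative `d`, solves the linear equation
`∂ₜz + ∂ₓ³z - ∂ₓ²z = g`, expressed as the integrated ordinary differential equations of its Fourier
coefficients. -/
structure IsModeSolution (z d : ℝ → L2) (g : ℝ → ℝ → ℝ) : Prop where
  hasPerDeriv : ∀ t, 0 ≤ t → HasPerDeriv (z t) (d t)
  cont : ContinuousOn z (Set.Ici 0)
  cont_d : ContinuousOn d (Set.Ici 0)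
  memLp : ∀ t, 0 ≤ t → MemLp (g t) 2 circ
  cont_cos : ∀ k, ContinuousOn (fun t => cosCoeff (g t) k) (Set.Ici 0)
  cont_sin : ∀ k, ContinuousOn (fun t => sinCoeff (g t) k) (Set.Ici 0)
  cos_eq : ∀ k t, 0 ≤ t → cosCoeff (z t) k - cosCoeff (z 0) k = ∫ s in (0 : ℝ)..t,
    (freq k ^ 3 * sinCoeff (z s) k - freq k ^ 2 * cosCoeff (z s) k + cosCoeff (g s) k)
  sin_eq : ∀ k t, 0 ≤ t → sinCoeff (z t) k - sinCoeff (z 0) k = ∫ s in (0 : ℝ)..t,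
    (-freq k ^ 3 * cosCoeff (z s) k - freq k ^ 2 * sinCoeff (z s) k + sinCoeff (g s) k)

lemma memLp_of_test {φ : ℝ → ℝ} (hφ : Continuous φ) (hb : ∀ x, |φ x| ≤ 1) : MemLp φ 2 circ :=
  MemLp.of_bound hφ.aestronglyMeasurable 1 (.of_forall fun x => by simpa using hb x)

lemma continuous_integral_mul {φ : ℝ → ℝ} (hφ : Continuous φ) (hb : ∀ x, |φ x| ≤ 1) :
    Continuous fun f : L2 => ∫ x, f x * φ x ∂circ := by
  have h : (fun f : L2 => ∫ x, f x * φ x ∂circ) =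
      fun f : L2 => (inner ℝ f (memLp_of_test hφ hb).toLp : ℝ) := by
    ext f
    rw [inner_eq]
    refine integral_congr_ae ?_
    filter_upwards [(memLp_of_test hφ hb).coeFn_toLp] with x hx
    rw [hx]
  rw [h]
  fun_prop

lemma continuous_integral_sq_mul {φ : ℝ → ℝ} (hφ : Continuous φ) (hb : ∀ x, |φ x| ≤ 1) :
    Continuous fun f : L2 => ∫ x, f x ^ 2 * φ x ∂circ := by
  have hi : ∀ f : L2, Integrable (fun x => f x ^ 2 * φ x) circ := fun f =>
    integrable_mul_bdd (memLp_coe f).integrable_sq hφ hb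
  have hdiff : ∀ f g : L2, |∫ x, f x ^ 2 * φ x ∂circ - ∫ x, g x ^ 2 * φ x ∂circ| ≤
      ‖f - g‖ * ‖f + g‖ := by
    intro f g
    have h1 := integral_abs_mul_le (memLp_coe (f - g)) (memLp_coe (f + g))
    rw [← norm_sq_eq, ← norm_sq_eq, Real.sqrt_sq (norm_nonneg _), Real.sqrt_sq (norm_nonneg _)]
      at h1
    rw [← integral_sub (hi f) (hi g)]
    refine le_trans (abs_integral_le_integral_abs.trans (integral_mono_ae ?_ ?_ ?_)) h1
    · exact ((hi f).sub (hi g)).abs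
    · exact (integrable_mul_of_memLp (memLp_coe _) (memLp_coe _)).abs
    · filter_upwards [Lp.coeFn_sub f g, Lp.coeFn_add f g] with x h2 h3
      rw [h2, h3, Pi.sub_apply, Pi.add_apply,
        show f x ^ 2 * φ x - g x ^ 2 * φ x = (f x - g x) * (f x + g x) * φ x by ring, abs_mul _ (φ x)]
      exact mul_le_of_le_one_right (abs_nonneg _) (hb x)
  rw [continuous_iff_continuousAt]
  intro g
  refine tendsto_iff_dist_tendsto_zero.2 (squeeze_zero (fun f => dist_nonneg)
    (fun f => hdiff f g) ?_)
  have : ContinuousAt (fun f : L2 => ‖f - g‖ * ‖f + g‖) g := by fun_prop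
  simpa [ContinuousAt] using this

lemma continuous_cosCoeff (k : ℤ) : Continuous fun f : L2 => cosCoeff f k :=
  continuous_integral_mul (by fun_prop) fun _ => Real.abs_cos_le_one _

lemma continuous_sinCoeff (k : ℤ) : Continuous fun f : L2 => sinCoeff f k :=
  continuous_integral_mul (by fun_prop) fun _ => Real.abs_sin_le_one _

/-! ### Products of functions with weak derivatives -/

/-- Agmon's inequality for a mean-zero element of `L²` with a weak derivative. -/
lemma HasPerDeriv.sq_le {f d : L2} (h : HasPerDeriv f d) (h0 : MeanZero f) :
    ∀ᵐ x ∂circ, f x ^ 2 ≤ ‖f‖ * ‖d‖ := by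
  have := h.perAC.sq_le (memLp_coe f) (memLp_coe d) (by rw [← intervalIntegral_eq]; exact h0)
  rwa [← norm_sq_eq, ← norm_sq_eq, Real.sqrt_sq (norm_nonneg _), Real.sqrt_sq (norm_nonneg _)]
    at this

lemma memLp_mul {f d : L2} (h : HasPerDeriv f d) (h0 : MeanZero f) (e : L2) :
    MemLp (fun x => f x * e x) 2 circ := by
  have : MemLp f ⊤ circ := by
    refine memLp_top_of_bound (Lp.aestronglyMeasurable f) (√(‖f‖ * ‖d‖)) ?_
    filter_upwards [h.sq_le h0] with x hx
    rw [Real.norm_eq_abs]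
    exact Real.abs_le_sqrt hx
  exact MemLp.mul (memLp_coe e) this

/-- The square of the norm of a product in `L²`, by Agmon's inequality for one factor. -/
lemma integral_mul_sq_le {f d : L2} (h : HasPerDeriv f d) (h0 : MeanZero f) (e : L2) :
    ∫ x, (f x * e x) ^ 2 ∂circ ≤ ‖f‖ * ‖d‖ * ‖e‖ ^ 2 := by
  rw [norm_sq_eq e, ← integral_const_mul]
  refine integral_mono_ae (memLp_mul h h0 e).integrable_sq
    ((memLp_coe e).integrable_sq.const_mul _) ?_
  filter_upwards [h.sq_le h0] with x hx
  simp only [mul_pow]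
  exact mul_le_mul_of_nonneg_right hx (sq_nonneg _)

/-- The nonlinearity in divergence form: `½ (f², φ') = -(f ∂ₓf, φ)`. -/
lemma HasPerDeriv.integral_sq_mul_deriv {f d : L2} (h : HasPerDeriv f d) {φ : ℝ → ℝ}
    (hφ : IsTest φ) :
    ∫ x, f x ^ 2 / 2 * deriv φ x ∂circ = -∫ x, f x * d x * φ x ∂circ := by
  have hc : Continuous φ := hφ.1.continuous
  have hd : Continuous (deriv φ) := hφ.1.continuous_deriv (by simp)
  have h1 := ((h.perAC.mul h.perAC).mul hφ.perAC).integral_eq_zero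
  have i1 : Integrable (fun x => f x * d x * φ x) circ :=
    integrable_mul_of_continuous hc (integrable_mul_of_memLp (memLp_coe f) (memLp_coe d))
  have i2 : Integrable (fun x => f x ^ 2 / 2 * deriv φ x) circ :=
    integrable_mul_of_continuous hd ((memLp_coe f).integrable_sq.div_const 2)
  have h2 : ∫ x, 2 * (f x * d x * φ x + f x ^ 2 / 2 * deriv φ x) ∂circ = 0 :=
    (integral_congr_ae (.of_forall fun x => by ring)).trans h1
  rw [integral_const_mul, integral_add i1 i2] at h2
  linarith

lemma iteratedDeriv_two_cos (a : ℝ) :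
    iteratedDeriv 2 (fun x => Real.cos (a * x)) = fun x => -a ^ 2 * Real.cos (a * x) := by
  rw [iteratedDeriv_succ, iteratedDeriv_one, deriv_cos_freq]
  ext x
  rw [deriv_const_mul_field, deriv_sin_freq]
  ring

lemma iteratedDeriv_two_sin (a : ℝ) :
    iteratedDeriv 2 (fun x => Real.sin (a * x)) = fun x => -a ^ 2 * Real.sin (a * x) := by
  rw [iteratedDeriv_succ, iteratedDeriv_one, deriv_sin_freq]
  ext x
  rw [deriv_const_mul_field, deriv_cos_freq]
  ring

lemma iteratedDeriv_three_cos (a : ℝ) :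
    iteratedDeriv 3 (fun x => Real.cos (a * x)) = fun x => a ^ 3 * Real.sin (a * x) := by
  rw [iteratedDeriv_succ, iteratedDeriv_two_cos]
  ext x
  rw [deriv_const_mul_field, deriv_cos_freq]
  ring

lemma iteratedDeriv_three_sin (a : ℝ) :
    iteratedDeriv 3 (fun x => Real.sin (a * x)) = fun x => -a ^ 3 * Real.cos (a * x) := by
  rw [iteratedDeriv_succ, iteratedDeriv_two_sin]
  ext x
  rw [deriv_const_mul_field, deriv_sin_freq]
  ring

/-- The right-hand side of the weak formulation at a test function, after integration by parts in
the nonlinearity. -/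
lemma integral_weak_eq {f d F : L2} (h : HasPerDeriv f d) {φ : ℝ → ℝ} (hφ : IsTest φ) {a b : ℝ}
    {ψ : ℝ → ℝ} (hψ : Continuous ψ) (h3 : iteratedDeriv 3 φ = fun x => a * ψ x)
    (h2 : iteratedDeriv 2 φ = fun x => b * φ x) :
    ∫ x in (0 : ℝ)..1, (f x * iteratedDeriv 3 φ x + (f x) ^ 2 / 2 * deriv φ x
        + f x * iteratedDeriv 2 φ x + F x * φ x) =
      a * (∫ x, f x * ψ x ∂circ) + b * (∫ x, f x * φ x ∂circ)
        + ∫ x, (F x - f x * d x) * φ x ∂circ := by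
  have hc : Continuous φ := hφ.1.continuous
  have hd : Continuous (deriv φ) := hφ.1.continuous_deriv (by simp)
  have hf := (memLp_coe f).integrable one_le_two
  have hF := (memLp_coe F).integrable one_le_two
  have hfd := integrable_mul_of_memLp (memLp_coe f) (memLp_coe d)
  have i1 : Integrable (fun x => a * (f x * ψ x)) circ :=
    (integrable_mul_of_continuous hψ hf).const_mul a
  have i2 : Integrable (fun x => b * (f x * φ x)) circ :=
    (integrable_mul_of_continuous hc hf).const_mul b
  have i3 : Integrable (fun x => f x ^ 2 / 2 * deriv φ x) circ :=
    integrable_mul_of_continuous hd ((memLp_coe f).integrable_sq.div_const 2)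
  have i4 : Integrable (fun x => F x * φ x) circ := integrable_mul_of_continuous hc hF
  have i5 : Integrable (fun x => f x * d x * φ x) circ := integrable_mul_of_continuous hc hfd
  have i13 : Integrable (fun x => a * (f x * ψ x) + f x ^ 2 / 2 * deriv φ x) circ := i1.add i3
  have i132 : Integrable
      (fun x => a * (f x * ψ x) + f x ^ 2 / 2 * deriv φ x + b * (f x * φ x)) circ := i13.add i2
  have e1 : ∫ x, (f x * iteratedDeriv 3 φ x + (f x) ^ 2 / 2 * deriv φ x
        + f x * iteratedDeriv 2 φ x + F x * φ x) ∂circ =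
      ∫ x, (a * (f x * ψ x) + f x ^ 2 / 2 * deriv φ x + b * (f x * φ x) + F x * φ x) ∂circ := by
    refine integral_congr_ae (.of_forall fun x => ?_)
    simp only [h3, h2]
    ring
  rw [intervalIntegral_eq, e1, integral_add i132 i4, integral_add i13 i2,
    integral_add i1 i3, integral_const_mul, integral_const_mul, h.integral_sq_mul_deriv hφ]
  simp only [sub_mul]
  rw [integral_sub i4 i5]
  ring

lemma IsSolution.isModeSolution {F v : ℝ → L2} (hv : IsSolution F v)
    (hF : ContinuousOn F (Set.Ici 0)) :
    IsModeSolution v (fun t => dx (v t)) (fun t x => F t x - v t x * dx (v t) x) := by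
  have hder : ∀ t, 0 ≤ t → HasPerDeriv (v t) (dx (v t)) := fun t ht =>
    (hv.mem t ht).hasPerDeriv le_rfl
  have hFi : ∀ t, Integrable (F t) circ := fun t => (memLp_coe _).integrable one_le_two
  have hvi : ∀ t, Integrable (fun x => v t x * dx (v t) x) circ := fun t =>
    integrable_mul_of_memLp (memLp_coe _) (memLp_coe _)
  refine ⟨hder, hv.cont, hv.cont_dx,
    fun t ht => (memLp_coe (F t)).sub (memLp_mul (hder t ht) (hv.mem t ht).2 _),
    fun k => ?_, fun k => ?_, fun k t ht => ?_, fun k t ht => ?_⟩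
  · have h1 : ContinuousOn (fun t => cosCoeff (F t) k
        + -freq k / 2 * ∫ x, v t x ^ 2 * Real.sin (freq k * x) ∂circ) (Set.Ici 0) :=
      ((continuous_cosCoeff k).comp_continuousOn hF).add (continuousOn_const.mul
        ((continuous_integral_sq_mul (φ := fun x => Real.sin (freq k * x)) (by fun_prop)
          fun _ => Real.abs_sin_le_one _).comp_continuousOn hv.cont))
    refine h1.congr fun t ht => ?_
    have h2 := (hder t ht).integral_sq_mul_deriv (isTest_cos k)
    rw [deriv_cos_freq] at h2
    simp only
    rw [cosCoeff_sub (hFi t) (hvi t), sub_eq_add_neg, ← integral_const_mul]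
    congr 1
    rw [cosCoeff, ← h2]
    exact integral_congr_ae (.of_forall fun x => by ring)
  · have h1 : ContinuousOn (fun t => sinCoeff (F t) k
        + freq k / 2 * ∫ x, v t x ^ 2 * Real.cos (freq k * x) ∂circ) (Set.Ici 0) :=
      ((continuous_sinCoeff k).comp_continuousOn hF).add (continuousOn_const.mul
        ((continuous_integral_sq_mul (φ := fun x => Real.cos (freq k * x)) (by fun_prop)
          fun _ => Real.abs_cos_le_one _).comp_continuousOn hv.cont))
    refine h1.congr fun t ht => ?_
    have h2 := (hder t ht).integral_sq_mul_deriv (isTest_sin k)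
    rw [deriv_sin_freq] at h2
    simp only
    rw [sinCoeff_sub (hFi t) (hvi t), sub_eq_add_neg, ← integral_const_mul]
    congr 1
    rw [sinCoeff, ← h2]
    exact integral_congr_ae (.of_forall fun x => by ring)
  · have h := hv.weak _ (isTest_cos k) t ht
    rw [intervalIntegral_eq, intervalIntegral_eq] at h
    refine h.trans (intervalIntegral.integral_congr fun s hs => ?_)
    rw [Set.uIcc_of_le ht] at hs
    rw [integral_weak_eq (hder s hs.1) (isTest_cos k) (ψ := fun x => Real.sin (freq k * x))
      (by fun_prop) (iteratedDeriv_three_cos _) (iteratedDeriv_two_cos _), cosCoeff, cosCoeff, sinCoeff]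
    ring
  · have h := hv.weak _ (isTest_sin k) t ht
    rw [intervalIntegral_eq, intervalIntegral_eq] at h
    refine h.trans (intervalIntegral.integral_congr fun s hs => ?_)
    rw [Set.uIcc_of_le ht] at hs
    rw [integral_weak_eq (hder s hs.1) (isTest_sin k) (ψ := fun x => Real.cos (freq k * x))
      (by fun_prop) (iteratedDeriv_three_sin _) (iteratedDeriv_two_sin _), sinCoeff, sinCoeff, cosCoeff]
    ring

namespace IsModeSolution

variable {z d z' d' : ℝ → L2} {g g' : ℝ → ℝ → ℝ}

lemma cont_cosCoeff (h : IsModeSolution z d g) (k : ℤ) :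
    ContinuousOn (fun t => cosCoeff (z t) k) (Set.Ici 0) :=
  (continuous_cosCoeff k).comp_continuousOn h.cont

lemma cont_sinCoeff (h : IsModeSolution z d g) (k : ℤ) :
    ContinuousOn (fun t => sinCoeff (z t) k) (Set.Ici 0) :=
  (continuous_sinCoeff k).comp_continuousOn h.cont

lemma cont_cos_rhs (h : IsModeSolution z d g) (k : ℤ) : ContinuousOn (fun s =>
    freq k ^ 3 * sinCoeff (z s) k - freq k ^ 2 * cosCoeff (z s) k + cosCoeff (g s) k)
    (Set.Ici 0) :=
  ((continuousOn_const.mul (h.cont_sinCoeff k)).sub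
    (continuousOn_const.mul (h.cont_cosCoeff k))).add (h.cont_cos k)

lemma cont_sin_rhs (h : IsModeSolution z d g) (k : ℤ) : ContinuousOn (fun s =>
    -freq k ^ 3 * cosCoeff (z s) k - freq k ^ 2 * sinCoeff (z s) k + sinCoeff (g s) k)
    (Set.Ici 0) :=
  ((continuousOn_const.mul (h.cont_cosCoeff k)).sub
    (continuousOn_const.mul (h.cont_sinCoeff k))).add (h.cont_sin k)

lemma sub (h : IsModeSolution z d g) (h' : IsModeSolution z' d' g') :
    IsModeSolution (fun t => z t - z' t) (fun t => d t - d' t) (fun t x => g t x - g' t x) := by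
  have i : ∀ f : L2, Integrable f circ := fun f => (memLp_coe f).integrable one_le_two
  have ig : ∀ t, 0 ≤ t → Integrable (g t) circ := fun t ht => (h.memLp t ht).integrable one_le_two
  have ig' : ∀ t, 0 ≤ t → Integrable (g' t) circ := fun t ht =>
    (h'.memLp t ht).integrable one_le_two
  have ec : ∀ t k, cosCoeff (z t - z' t : L2) k = cosCoeff (z t) k - cosCoeff (z' t) k :=
    fun t k => by
      rw [← cosCoeff_sub (i _) (i _)]
      exact cosCoeff_congr (Lp.coeFn_sub _ _) k
  have es : ∀ t k, sinCoeff (z t - z' t : L2) k = sinCoeff (z t) k - sinCoeff (z' t) k :=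
    fun t k => by
      rw [← sinCoeff_sub (i _) (i _)]
      exact sinCoeff_congr (Lp.coeFn_sub _ _) k
  have ii : ∀ {f : ℝ → ℝ} {t : ℝ}, 0 ≤ t → ContinuousOn f (Set.Ici 0) →
      IntervalIntegrable f volume 0 t := fun ht hf => by
    refine (hf.mono ?_).intervalIntegrable
    rw [Set.uIcc_of_le ht]
    exact fun τ hτ => hτ.1
  refine ⟨fun t ht => (h.hasPerDeriv t ht).sub (h'.hasPerDeriv t ht), h.cont.sub h'.cont,
    h.cont_d.sub h'.cont_d, fun t ht => (h.memLp t ht).sub (h'.memLp t ht), fun k => ?_,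
    fun k => ?_, fun k t ht => ?_, fun k t ht => ?_⟩
  · exact ((h.cont_cos k).sub (h'.cont_cos k)).congr fun t ht => cosCoeff_sub (ig t ht) (ig' t ht) k
  · exact ((h.cont_sin k).sub (h'.cont_sin k)).congr fun t ht => sinCoeff_sub (ig t ht) (ig' t ht) k
  · rw [ec, ec, show ∀ a b c e : ℝ, a - b - (c - e) = (a - c) - (b - e) by intros; ring,
      h.cos_eq k t ht, h'.cos_eq k t ht, ← intervalIntegral.integral_sub (ii ht (h.cont_cos_rhs k))
        (ii ht (h'.cont_cos_rhs k))]
    refine intervalIntegral.integral_congr fun s hs => ?_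
    rw [Set.uIcc_of_le ht] at hs
    rw [ec, es, cosCoeff_sub (ig s hs.1) (ig' s hs.1)]
    ring
  · rw [es, es, show ∀ a b c e : ℝ, a - b - (c - e) = (a - c) - (b - e) by intros; ring,
      h.sin_eq k t ht, h'.sin_eq k t ht, ← intervalIntegral.integral_sub (ii ht (h.cont_sin_rhs k))
        (ii ht (h'.cont_sin_rhs k))]
    refine intervalIntegral.integral_congr fun s hs => ?_
    rw [Set.uIcc_of_le ht] at hs
    rw [ec, es, sinCoeff_sub (ig s hs.1) (ig' s hs.1)]
    ring

/-- The energy balance of a single Fourier mode; the dispersive term drops out. -/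
lemma mode_energy (h : IsModeSolution z d g) (k : ℤ) {s t : ℝ} (hs : 0 ≤ s) (hst : s ≤ t) :
    (cosCoeff (z t) k ^ 2 + sinCoeff (z t) k ^ 2) - (cosCoeff (z s) k ^ 2 + sinCoeff (z s) k ^ 2) =
      ∫ τ in s..t, (-2 * (freq k ^ 2 * (cosCoeff (z τ) k ^ 2 + sinCoeff (z τ) k ^ 2)) +
        2 * (cosCoeff (z τ) k * cosCoeff (g τ) k + sinCoeff (z τ) k * sinCoeff (g τ) k)) := by
  rw [sq_add_sq_sub_eq_integral (h.cont_cosCoeff k) (h.cont_sinCoeff k) (h.cont_cos_rhs k)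
    (h.cont_sin_rhs k) (h.cos_eq k) (h.sin_eq k) hs hst]
  refine intervalIntegral.integral_congr fun τ _ => ?_
  ring

end IsModeSolution

/-! ### Energy inequalities -/

namespace IsModeSolution

variable {z d : ℝ → L2} {g : ℝ → ℝ → ℝ}

lemma hasSum_d (h : IsModeSolution z d g) {t : ℝ} (ht : 0 ≤ t) :
    HasSum (fun k => freq k ^ 2 * (cosCoeff (z t) k ^ 2 + sinCoeff (z t) k ^ 2)) (‖d t‖ ^ 2) :=
  (h.hasPerDeriv t ht).hasSum

lemma hasSum_z (z : ℝ → L2) (t : ℝ) :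
    HasSum (fun k => cosCoeff (z t) k ^ 2 + sinCoeff (z t) k ^ 2) (‖z t‖ ^ 2) := by
  rw [norm_sq_eq]
  exact hasSum_coeff_sq (memLp_coe _)

lemma hasSum_g (h : IsModeSolution z d g) {t : ℝ} (ht : 0 ≤ t) :
    HasSum (fun k => cosCoeff (g t) k ^ 2 + sinCoeff (g t) k ^ 2) (∫ x, g t x ^ 2 ∂circ) :=
  hasSum_coeff_sq (h.memLp t ht)

lemma cont_mode_rhs (h : IsModeSolution z d g) (k : ℤ) : ContinuousOn (fun τ =>
    -2 * (freq k ^ 2 * (cosCoeff (z τ) k ^ 2 + sinCoeff (z τ) k ^ 2)) +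
      2 * (cosCoeff (z τ) k * cosCoeff (g τ) k + sinCoeff (z τ) k * sinCoeff (g τ) k))
    (Set.Ici 0) :=
  (continuousOn_const.mul (continuousOn_const.mul (((h.cont_cosCoeff k).pow 2).add
    ((h.cont_sinCoeff k).pow 2)))).add (continuousOn_const.mul
      (((h.cont_cosCoeff k).mul (h.cont_cos k)).add ((h.cont_sinCoeff k).mul (h.cont_sin k))))

/-- The `L²` energy inequality. -/
lemma energy_le (h : IsModeSolution z d g) {s t B : ℝ} {r : ℝ → ℝ} (hs : 0 ≤ s) (hst : s ≤ t)
    (hr : ContinuousOn r (Set.Icc s t)) (hB : ∀ τ ∈ Set.Icc s t, ∫ x, g τ x ^ 2 ∂circ ≤ B)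
    (hle : ∀ τ ∈ Set.Icc s t, -2 * ‖d τ‖ ^ 2 + 2 * ∫ x, z τ x * g τ x ∂circ ≤ r τ) :
    ‖z t‖ ^ 2 - ‖z s‖ ^ 2 ≤ ∫ τ in s..t, r τ := by
  have sub : Set.Icc s t ⊆ Set.Ici 0 := fun τ hτ => hs.trans hτ.1
  obtain ⟨C, hC⟩ := isCompact_Icc.exists_bound_of_continuousOn (s := Set.Icc s t)
    (f := fun τ => 2 * ‖d τ‖ ^ 2 + ‖z τ‖ ^ 2)
    (((continuousOn_const.mul (h.cont_d.norm.pow 2)).add (h.cont.norm.pow 2)).mono sub)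
  refine sub_le_integral_of_tendsto (C := C + B) (y := fun τ => ‖z τ‖ ^ 2)
    (Y := fun A τ => ∑ k ∈ A, (cosCoeff (z τ) k ^ 2 + sinCoeff (z τ) k ^ 2))
    (q := fun A τ => ∑ k ∈ A,
      (-2 * (freq k ^ 2 * (cosCoeff (z τ) k ^ 2 + sinCoeff (z τ) k ^ 2)) +
        2 * (cosCoeff (z τ) k * cosCoeff (g τ) k + sinCoeff (z τ) k * sinCoeff (g τ) k)))
    hst (fun A => ?_) hr (fun A τ hτ => ?_) (fun τ hτ => ?_) hle (hasSum_z z s) (hasSum_z z t)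
    (fun A => ?_)
  · exact continuousOn_finsetSum _ fun k _ => (h.cont_mode_rhs k).mono sub
  · have hτ0 := sub hτ
    have h1 := sum_le_hasSum A (fun k _ => by positivity) (h.hasSum_d hτ0)
    have h2 := sum_le_hasSum A (fun k _ => by positivity) (hasSum_z z τ)
    have h3 := (sum_le_hasSum A (fun k _ => by positivity) (h.hasSum_g hτ0)).trans (hB τ hτ)
    have h4 := (le_abs_self _).trans (hC τ hτ)
    refine (Finset.abs_sum_le_sum_abs _ _).trans ?_
    have h5 : ∀ k ∈ A, |-2 * (freq k ^ 2 * (cosCoeff (z τ) k ^ 2 + sinCoeff (z τ) k ^ 2)) +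
        2 * (cosCoeff (z τ) k * cosCoeff (g τ) k + sinCoeff (z τ) k * sinCoeff (g τ) k)| ≤
        2 * (freq k ^ 2 * (cosCoeff (z τ) k ^ 2 + sinCoeff (z τ) k ^ 2)) +
          (cosCoeff (z τ) k ^ 2 + sinCoeff (z τ) k ^ 2) +
          (cosCoeff (g τ) k ^ 2 + sinCoeff (g τ) k ^ 2) := fun k _ => by
      have h0 : 0 ≤ freq k ^ 2 * (cosCoeff (z τ) k ^ 2 + sinCoeff (z τ) k ^ 2) := by positivity
      refine abs_le.2 ⟨?_, ?_⟩
      · nlinarith [sq_nonneg (cosCoeff (z τ) k + cosCoeff (g τ) k),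
          sq_nonneg (sinCoeff (z τ) k + sinCoeff (g τ) k)]
      · nlinarith [sq_nonneg (cosCoeff (z τ) k - cosCoeff (g τ) k),
          sq_nonneg (sinCoeff (z τ) k - sinCoeff (g τ) k)]
    refine (Finset.sum_le_sum h5).trans ?_
    rw [Finset.sum_add_distrib, Finset.sum_add_distrib, ← Finset.mul_sum]
    linarith
  · exact ((h.hasSum_d (sub hτ)).mul_left (-2)).add
      ((hasSum_coeff_mul (memLp_coe (z τ)) (h.memLp τ (sub hτ))).mul_left 2)
  · rw [← Finset.sum_sub_distrib, intervalIntegral.integral_finsetSum]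
    · exact (Finset.sum_congr rfl fun k _ => h.mode_energy k hs hst).le
    · intro k _
      refine ContinuousOn.intervalIntegrable ?_
      rw [Set.uIcc_of_le hst]
      exact (h.cont_mode_rhs k).mono sub

/-- The `H¹` energy inequality. The dissipation `‖∂ₓ²z‖²` absorbs the forcing mode by mode, and
what is left of it controls `‖∂ₓz‖⁴ / ‖z‖²`, by interpolation. -/
lemma energy_dx_le (h : IsModeSolution z d g) {s t R : ℝ} {Γ : ℝ → ℝ} (hs : 0 ≤ s) (hst : s ≤ t)
    (hR : 0 < R) (hzR : ∀ τ ∈ Set.Icc s t, ‖z τ‖ ^ 2 ≤ R) (hΓ : ContinuousOn Γ (Set.Icc s t))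
    (hg : ∀ τ ∈ Set.Icc s t, ∫ x, g τ x ^ 2 ∂circ ≤ Γ τ) :
    ‖d t‖ ^ 2 - ‖d s‖ ^ 2 ≤ ∫ τ in s..t, (Γ τ - (‖d τ‖ ^ 2) ^ 2 / R) := by
  have sub : Set.Icc s t ⊆ Set.Ici 0 := fun τ hτ => hs.trans hτ.1
  set Y : Finset ℤ → ℝ → ℝ := fun A τ =>
    ∑ k ∈ A, freq k ^ 2 * (cosCoeff (z τ) k ^ 2 + sinCoeff (z τ) k ^ 2) with hY
  have hYc : ∀ A, ContinuousOn (Y A) (Set.Icc s t) := fun A =>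
    continuousOn_finsetSum _ fun k _ => (continuousOn_const.mul
      (((h.cont_cosCoeff k).pow 2).add ((h.cont_sinCoeff k).pow 2))).mono sub
  have hdc : ContinuousOn (fun τ => (‖d τ‖ ^ 2) ^ 2 / R) (Set.Icc s t) :=
    (((h.cont_d.norm.pow 2).pow 2).div_const R).mono sub
  obtain ⟨C, hC⟩ := isCompact_Icc.exists_bound_of_continuousOn (s := Set.Icc s t)
    (f := fun τ => |Γ τ| + (‖d τ‖ ^ 2) ^ 2 / R) (hΓ.abs.add hdc)
  have hYle : ∀ A, ∀ τ ∈ Set.Icc s t, Y A τ ≤ ‖d τ‖ ^ 2 := fun A τ hτ =>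
    sum_le_hasSum A (fun k _ => by positivity) (h.hasSum_d (sub hτ))
  have hY0 : ∀ A τ, 0 ≤ Y A τ := fun A τ => Finset.sum_nonneg fun k _ => by positivity
  refine sub_le_integral_of_tendsto (C := C) (y := fun τ => ‖d τ‖ ^ 2) (Y := Y)
    (q := fun A τ => Γ τ - Y A τ ^ 2 / R) (q₀ := fun τ => Γ τ - (‖d τ‖ ^ 2) ^ 2 / R)
    hst (fun A => hΓ.sub (((hYc A).pow 2).div_const R)) (hΓ.sub hdc) (fun A τ hτ => ?_)
    (fun τ hτ => ?_) (fun τ hτ => le_rfl) (h.hasSum_d hs) (h.hasSum_d (hs.trans hst)) (fun A => ?_)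
  · refine (abs_sub _ _).trans (le_trans ?_ ((le_abs_self _).trans (hC τ hτ)))
    rw [abs_of_nonneg (a := Y A τ ^ 2 / R) (by positivity)]
    gcongr
    exact hYle A τ hτ
  · exact (((h.hasSum_d (sub hτ)).pow 2).div_const R).const_sub (Γ τ)
  · have hii : ∀ k ∈ A, IntervalIntegrable (fun τ => freq k ^ 2 *
        (-2 * (freq k ^ 2 * (cosCoeff (z τ) k ^ 2 + sinCoeff (z τ) k ^ 2)) +
          2 * (cosCoeff (z τ) k * cosCoeff (g τ) k + sinCoeff (z τ) k * sinCoeff (g τ) k)))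
        volume s t := fun k _ => by
      refine ContinuousOn.intervalIntegrable ?_
      rw [Set.uIcc_of_le hst]
      exact (continuousOn_const.mul (h.cont_mode_rhs k)).mono sub
    have e : Y A t - Y A s = ∫ τ in s..t, ∑ k ∈ A, freq k ^ 2 *
        (-2 * (freq k ^ 2 * (cosCoeff (z τ) k ^ 2 + sinCoeff (z τ) k ^ 2)) +
          2 * (cosCoeff (z τ) k * cosCoeff (g τ) k + sinCoeff (z τ) k * sinCoeff (g τ) k)) := by
      rw [intervalIntegral.integral_finsetSum hii, hY]
      simp only
      rw [← Finset.sum_sub_distrib]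
      refine Finset.sum_congr rfl fun k _ => ?_
      rw [intervalIntegral.integral_const_mul, ← h.mode_energy k hs hst]
      ring
    rw [e]
    refine intervalIntegral.integral_mono_on hst ?_ ?_ fun τ hτ => ?_
    · refine ContinuousOn.intervalIntegrable ?_
      rw [Set.uIcc_of_le hst]
      exact continuousOn_finsetSum _ fun k _ =>
        (continuousOn_const.mul (h.cont_mode_rhs k)).mono sub
    · refine ContinuousOn.intervalIntegrable ?_
      rw [Set.uIcc_of_le hst]
      exact hΓ.sub (((hYc A).pow 2).div_const R)
    · set Z : ℝ := ∑ k ∈ A, freq k ^ 4 * (cosCoeff (z τ) k ^ 2 + sinCoeff (z τ) k ^ 2) with hZ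
      have h1 : ∑ k ∈ A, freq k ^ 2 *
          (-2 * (freq k ^ 2 * (cosCoeff (z τ) k ^ 2 + sinCoeff (z τ) k ^ 2)) +
          2 * (cosCoeff (z τ) k * cosCoeff (g τ) k + sinCoeff (z τ) k * sinCoeff (g τ) k)) ≤
          ∑ k ∈ A, ((cosCoeff (g τ) k ^ 2 + sinCoeff (g τ) k ^ 2) -
            freq k ^ 4 * (cosCoeff (z τ) k ^ 2 + sinCoeff (z τ) k ^ 2)) := by
        refine Finset.sum_le_sum fun k _ => ?_
        nlinarith [sq_nonneg (freq k ^ 2 * cosCoeff (z τ) k - cosCoeff (g τ) k),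
          sq_nonneg (freq k ^ 2 * sinCoeff (z τ) k - sinCoeff (g τ) k)]
      have h2 : ∑ k ∈ A, (cosCoeff (g τ) k ^ 2 + sinCoeff (g τ) k ^ 2) ≤ Γ τ :=
        (sum_le_hasSum A (fun k _ => by positivity) (h.hasSum_g (sub hτ))).trans (hg τ hτ)
      have h3 : Y A τ ^ 2 / R ≤ Z := by
        have hcs := Finset.sum_sq_le_sum_mul_sum_of_sq_le_mul A
          (r := fun k => freq k ^ 2 * (cosCoeff (z τ) k ^ 2 + sinCoeff (z τ) k ^ 2))
          (f := fun k => cosCoeff (z τ) k ^ 2 + sinCoeff (z τ) k ^ 2)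
          (g := fun k => freq k ^ 4 * (cosCoeff (z τ) k ^ 2 + sinCoeff (z τ) k ^ 2))
          (fun k _ => by positivity) (fun k _ => by positivity) (fun k _ => le_of_eq (by ring))
        have hzle := (sum_le_hasSum A (fun k _ => by positivity) (hasSum_z z τ)).trans (hzR τ hτ)
        have hZ0 : 0 ≤ Z := Finset.sum_nonneg fun k _ => by positivity
        rw [div_le_iff₀ hR, mul_comm]
        exact hcs.trans (mul_le_mul_of_nonneg_right hzle hZ0)
      refine h1.trans ?_
      rw [Finset.sum_sub_distrib, ← hZ]
      linarith

end IsModeSolution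

/-! ### The absorbing set of the Korteweg–de Vries–Burgers equation -/

lemma integral_sub_sq_le {a b : ℝ → ℝ} (ha : MemLp a 2 circ) (hb : MemLp b 2 circ) :
    ∫ x, (a x - b x) ^ 2 ∂circ ≤ (√(∫ x, a x ^ 2 ∂circ) + √(∫ x, b x ^ 2 ∂circ)) ^ 2 := by
  have h1 : ∫ x, (a x - b x) ^ 2 ∂circ =
      ∫ x, a x ^ 2 ∂circ + ∫ x, b x ^ 2 ∂circ - 2 * ∫ x, a x * b x ∂circ := by
    have i : Integrable (fun x => a x ^ 2 + b x ^ 2) circ := ha.integrable_sq.add hb.integrable_sq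
    rw [← integral_add ha.integrable_sq hb.integrable_sq, ← integral_const_mul,
      ← integral_sub i ((integrable_mul_of_memLp ha hb).const_mul 2)]
    exact integral_congr_ae (.of_forall fun x => by ring)
  have h2 := neg_le_of_abs_le (abs_integral_mul_le ha hb)
  have h3 := Real.sq_sqrt (integral_nonneg (μ := circ) fun x => sq_nonneg (a x))
  have h4 := Real.sq_sqrt (integral_nonneg (μ := circ) fun x => sq_nonneg (b x))
  rw [h1, add_sq, h3, h4]
  linarith

lemma integral_rhs_sq_le {F f d : L2} (h : HasPerDeriv f d) (h0 : MeanZero f) :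
    ∫ x, (F x - f x * d x) ^ 2 ∂circ ≤ (‖F‖ + √(‖f‖ * ‖d‖) * ‖d‖) ^ 2 := by
  refine (integral_sub_sq_le (memLp_coe F) (memLp_mul h h0 d)).trans ?_
  rw [← norm_sq_eq, Real.sqrt_sq (norm_nonneg _)]
  have : √(∫ x, (f x * d x) ^ 2 ∂circ) ≤ √(‖f‖ * ‖d‖) * ‖d‖ := by
    refine (Real.sqrt_le_sqrt (integral_mul_sq_le h h0 d)).trans ?_
    rw [Real.sqrt_mul (by positivity), Real.sqrt_sq (norm_nonneg _)]
  gcongr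

lemma IsSolution.exists_bound_rhs {F v : ℝ → L2} (hv : IsSolution F v)
    (hF : ContinuousOn F (Set.Ici 0)) {s t : ℝ} (hs : 0 ≤ s) :
    ∃ B, ∀ τ ∈ Set.Icc s t, ∫ x, (F τ x - v τ x * dx (v τ) x) ^ 2 ∂circ ≤ B := by
  have sub : Set.Icc s t ⊆ Set.Ici 0 := fun τ hτ => hs.trans hτ.1
  obtain ⟨B, hB⟩ := isCompact_Icc.exists_bound_of_continuousOn (s := Set.Icc s t)
    (f := fun τ => (‖F τ‖ + √(‖v τ‖ * ‖dx (v τ)‖) * ‖dx (v τ)‖) ^ 2)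
    (((hF.norm.add ((hv.cont.norm.mul hv.cont_dx.norm).sqrt.mul hv.cont_dx.norm)).pow 2).mono sub)
  refine ⟨B, fun τ hτ => ?_⟩
  have hm := hv.mem τ (sub hτ)
  exact (integral_rhs_sq_le (hm.hasPerDeriv le_rfl) hm.2).trans ((le_abs_self _).trans (hB τ hτ))

lemma HasPerDeriv.integral_mul_self_mul {f d : L2} (h : HasPerDeriv f d) :
    ∫ x, f x * (f x * d x) ∂circ = 0 := by
  have h1 := ((h.perAC.mul h.perAC).mul h.perAC).integral_eq_zero
  have h2 : ∫ x, 3 * (f x * (f x * d x)) ∂circ = 0 :=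
    (integral_congr_ae (.of_forall fun x => by ring)).trans h1
  rw [integral_const_mul] at h2
  linarith

section Absorbing

variable {w : ℕ → L2} {lam : ℕ → ℝ} {h : L2} {v : ℝ → L2}

lemma IsEigenbasis.poincare (hw : IsEigenbasis w lam) {f d : L2} (hf : HasPerDeriv f d)
    (h0 : MeanZero f) : lam 1 * ‖f‖ ^ 2 ≤ ‖d‖ ^ 2 := by
  simpa using hw.spectral_gap hf h0 0

lemma IsSolution.eventually_norm_sq_le (hv : IsSolution (fun _ => h) v) (hw : IsEigenbasis w lam)
    {R : ℝ} (hR : 0 < R) (hRh : ‖h‖ ^ 2 < R * lam 1 ^ 2) : ∀ᶠ t in atTop, ‖v t‖ ^ 2 ≤ R := by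
  have hms := hv.isModeSolution continuousOn_const
  have hl : 0 < lam 1 := by linarith [hw.le_lam le_rfl]
  have hsR : 0 < √R := Real.sqrt_pos.2 hR
  have hc : 0 < lam 1 * √R - ‖h‖ := by
    have : ‖h‖ < lam 1 * √R := by
      refine lt_of_pow_lt_pow_left₀ 2 (by positivity) ?_
      rw [mul_pow, Real.sq_sqrt hR.le]
      linarith
    linarith
  have hrc : ContinuousOn (fun τ => -2 * lam 1 * ‖v τ‖ ^ 2 + 2 * (‖v τ‖ * ‖h‖)) (Set.Ici 0) :=
    (continuousOn_const.mul (hv.cont.norm.pow 2)).add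
      (continuousOn_const.mul (hv.cont.norm.mul continuousOn_const))
  refine eventually_le_of_sub_le_integral (T := 0) (c := 2 * √R * (lam 1 * √R - ‖h‖))
    (by positivity) (hv.cont.norm.pow 2) hrc (fun t _ => by positivity) (fun s t hs hst => ?_)
    fun t _ hY => ?_
  · obtain ⟨B, hB⟩ := hv.exists_bound_rhs continuousOn_const (t := t) hs
    refine hms.energy_le hs hst (hrc.mono fun τ hτ => hs.trans hτ.1) hB fun τ hτ => ?_
    have hm := hv.mem τ (hs.trans hτ.1)
    have hd := hm.hasPerDeriv le_rfl
    have h1 : ∫ x, v τ x * (h x - v τ x * dx (v τ) x) ∂circ = inner ℝ (v τ) h := by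
      have h2 := integral_sub (integrable_mul_of_memLp (memLp_coe (v τ)) (memLp_coe h))
        (integrable_mul_of_memLp (memLp_coe (v τ)) (memLp_mul hd hm.2 (dx (v τ))))
      rw [hd.integral_mul_self_mul, sub_zero, ← inner_eq] at h2
      exact (integral_congr_ae (.of_forall fun x => by ring)).trans h2
    rw [h1]
    have h2 := real_inner_le_norm (v τ) h
    have h3 := hw.poincare hd hm.2
    linarith
  · have h1 : √R ≤ ‖v t‖ := (Real.sqrt_le_sqrt hY).trans_eq (Real.sqrt_sq (norm_nonneg _))
    have h2 : lam 1 * √R - ‖h‖ ≤ lam 1 * ‖v t‖ - ‖h‖ := by gcongr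
    have h3 := mul_le_mul h1 h2 hc.le (norm_nonneg _)
    nlinarith

lemma IsSolution.eventually_norm_dx_sq_le (hv : IsSolution (fun _ => h) v)
    (hw : IsEigenbasis w lam) {R Y : ℝ} (hR : 0 < R) (hRh : ‖h‖ ^ 2 < R * lam 1 ^ 2)
    (hY : R ^ 3 + 4 * ‖h‖ * √R < Y) : ∀ᶠ t in atTop, ‖dx (v t)‖ ^ 2 ≤ Y := by
  have hms := hv.isModeSolution continuousOn_const
  obtain ⟨T₀, hT₀⟩ := eventually_atTop.1 (hv.eventually_norm_sq_le hw hR hRh)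
  set T := max T₀ 0 with hT
  have hT0 : 0 ≤ T := le_max_right _ _
  have hTR : ∀ τ, T ≤ τ → ‖v τ‖ ^ 2 ≤ R := fun τ hτ => hT₀ τ ((le_max_left _ _).trans hτ)
  set ρ := √R with hρdef
  have hρ : 0 < ρ := Real.sqrt_pos.2 hR
  have hρR : ρ ^ 2 = R := Real.sq_sqrt hR.le
  have hcd : ContinuousOn (fun τ => ‖dx (v τ)‖) (Set.Ici T) :=
    hv.cont_dx.norm.mono (Set.Ici_subset_Ici.2 hT0)
  set G : ℝ → ℝ := fun τ => ‖h‖ + √(ρ * ‖dx (v τ)‖) * ‖dx (v τ)‖ with hG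
  have hGc : ContinuousOn (fun τ => G τ ^ 2) (Set.Ici T) :=
    (continuousOn_const.add ((continuousOn_const.mul hcd).sqrt.mul hcd)).pow 2
  have hδ : 0 < Y / (4 * ρ) - ρ ^ 5 / 4 - ‖h‖ := by
    have : Y / (4 * ρ) - ρ ^ 5 / 4 - ‖h‖ = (Y - (R ^ 3 + 4 * ‖h‖ * ρ)) / (4 * ρ) := by
      rw [← hρR]; field_simp; ring
    rw [this]
    exact div_pos (by linarith) (by positivity)
  refine eventually_le_of_sub_le_integral (T := T) (c := (Y / (4 * ρ) - ρ ^ 5 / 4 - ‖h‖) ^ 2)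
    (by positivity) (hcd.pow 2) (hGc.sub (((hcd.pow 2).pow 2).div_const R))
    (fun t _ => by positivity) (fun s t hs hst => ?_) fun t ht hYt => ?_
  · have sub : Set.Icc s t ⊆ Set.Ici T := fun τ hτ => hs.trans hτ.1
    refine hms.energy_dx_le (hT0.trans hs) hst hR (fun τ hτ => hTR τ (sub hτ)) (hGc.mono sub)
      fun τ hτ => ?_
    have hm := hv.mem τ (hT0.trans (sub hτ))
    refine (integral_rhs_sq_le (hm.hasPerDeriv le_rfl) hm.2).trans ?_
    have : ‖v τ‖ ≤ ρ := Real.le_sqrt_of_sq_le (hTR τ (sub hτ))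
    simp only [hG]
    gcongr
  · set a := ‖dx (v t)‖ with ha
    have ha0 : 0 ≤ a := norm_nonneg _
    set x := √(ρ * a) with hx
    have hx0 : 0 ≤ x := Real.sqrt_nonneg _
    have hxa : a = x ^ 2 / ρ := by
      rw [hx, Real.sq_sqrt (by positivity)]
      field_simp
    -- The weighted inequality of arithmetic and geometric means, `4 x³ ρ² ≤ 3 x⁴ + ρ⁸`.
    have hyoung : x * a ≤ ρ ^ 5 / 4 + 3 * a ^ 2 / (4 * ρ) := by
      rw [← sub_nonneg]
      have : ρ ^ 5 / 4 + 3 * a ^ 2 / (4 * ρ) - x * a =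
          (x - ρ ^ 2) ^ 2 * (2 * x ^ 2 + (x + ρ ^ 2) ^ 2) / (4 * ρ ^ 3) := by
        rw [hxa]; field_simp; ring
      rw [this]
      positivity
    have hGt : G t = ‖h‖ + x * a := rfl
    have hG0 : 0 ≤ G t := by rw [hGt]; positivity
    have h1 : Y / (4 * ρ) ≤ a ^ 2 / (4 * ρ) := by gcongr
    have h2 : a ^ 2 / ρ = a ^ 2 / (4 * ρ) + 3 * a ^ 2 / (4 * ρ) := by field_simp; ring
    have h3 : Y / (4 * ρ) - ρ ^ 5 / 4 - ‖h‖ ≤ a ^ 2 / ρ - G t := by rw [hGt, h2]; linarith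
    have h4 : (a ^ 2) ^ 2 / R = (a ^ 2 / ρ) ^ 2 := by rw [← hρR]; field_simp
    change G t ^ 2 - (a ^ 2) ^ 2 / R ≤ _
    rw [h4]
    nlinarith

end Absorbing

/-! ### Comparison with the explicit constants -/

lemma quarter_mul_rpow_le {ρ : ℝ} (hρ : 1 ≤ ρ) :
    1 / 4 * ρ ^ 3 ≤ (1 / 3 * ρ ^ (5 / 2 : ℝ)) ^ (5 / 4 : ℝ) := by
  have hρ0 : 0 ≤ ρ := zero_le_one.trans hρ
  rw [Real.mul_rpow (by norm_num) (by positivity), ← Real.rpow_mul hρ0]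
  have h1 : (1 / 4 : ℝ) ≤ (1 / 3) ^ (5 / 4 : ℝ) := by
    have e1 : ((1 / 3 : ℝ) ^ 5) ^ (1 / 4 : ℝ) = (1 / 3) ^ (5 / 4 : ℝ) := by
      rw [← Real.rpow_natCast, ← Real.rpow_mul (by norm_num)]
      norm_num
    have e2 : ((1 / 4 : ℝ) ^ 4) ^ (1 / 4 : ℝ) = 1 / 4 := by
      rw [← Real.rpow_natCast, ← Real.rpow_mul (by norm_num)]
      norm_num
    calc (1 / 4 : ℝ) = ((1 / 4 : ℝ) ^ 4) ^ (1 / 4 : ℝ) := e2.symm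
      _ ≤ ((1 / 3 : ℝ) ^ 5) ^ (1 / 4 : ℝ) :=
        Real.rpow_le_rpow (by norm_num) (by norm_num) (by norm_num)
      _ = (1 / 3) ^ (5 / 4 : ℝ) := e1
  have h2 : ρ ^ 3 ≤ ρ ^ (5 / 2 * (5 / 4) : ℝ) := by
    rw [← Real.rpow_natCast]
    exact Real.rpow_le_rpow_of_exponent_le hρ (by norm_num)
  exact mul_le_mul h1 h2 (by positivity) (by positivity)

/-- The constant `M₀` leaves room for an admissible radius `R` of the absorbing ball in `L²`. For
`ρ₁ ≤ 1` one may take `R = 1`, and for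
`ρ₁ ≥ 1` the choice `R = (3/5) ρ₁` works because `(3/5)³ < 4/15 ≤ (16/15) 3^(-5/4)`. -/
lemma exists_radius {β l H : ℝ} (hβ : 1 ≤ β) (hl : 36 ≤ l) (hH : 0 ≤ H) :
    ∃ R : ℝ, 0 < R ∧ H ^ 2 < R * l ^ 2 ∧ R ^ 3 + 4 * H * √R < M0 β l H := by
  have hl0 : 0 < l := by linarith
  have hρ0 : 0 ≤ rho1 l H := by unfold rho1; positivity
  have hρl : rho1 l H * l ^ 2 = 2 * H ^ 2 := by unfold rho1; field_simp
  have hβ0 : 0 ≤ β := by linarith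
  have hl4 : 0 ≤ (l / 3) ^ 4 := by positivity
  have hl4' : 3 ≤ (l / 3) ^ 4 := by
    have : (2 : ℝ) ^ 4 ≤ (l / 3) ^ 4 := by gcongr; linarith
    linarith
  have hρ2 : 5 * H ^ 2 + (l / 3) ^ 4 + 1 ≤ rho2 β l H := by
    unfold rho2
    have : 0 ≤ 1 / (2 : ℝ) ^ (1 / 3 : ℝ) *
      (3 * β ^ 4 * rho1 l H ^ (7 / 4 : ℝ)) ^ (4 / 3 : ℝ) := by positivity
    linarith
  have hM : 8 / 3 * rho2 β l H ≤ M0 β l H := by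
    unfold M0
    exact le_add_of_nonneg_right (by positivity)
  have hl2 : 36 ^ 2 ≤ l ^ 2 := by gcongr
  rcases le_total (rho1 l H) 1 with h1 | h1
  · refine ⟨1, one_pos, ?_, ?_⟩
    · rw [one_mul]
      nlinarith
    · rw [Real.sqrt_one]
      nlinarith [sq_nonneg (H - 2)]
  · have hR0 : 0 < 3 / 5 * rho1 l H := by linarith
    refine ⟨3 / 5 * rho1 l H, hR0, ?_, ?_⟩
    · have : 0 < l ^ 2 := by positivity
      nlinarith
    · have hsq : √(3 / 5 * rho1 l H) ≤ H := by
        rw [Real.sqrt_le_left hH]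
        nlinarith
      have h2 : 16 / 15 * (1 / 4 * rho1 l H ^ 3) ≤
          16 / 15 * (1 / 3 * β ^ 3 * rho1 l H ^ (5 / 2 : ℝ)) ^ (5 / 4 : ℝ) := by
        refine mul_le_mul_of_nonneg_left ((quarter_mul_rpow_le h1).trans ?_) (by norm_num)
        have : 1 / 3 * 1 ≤ 1 / 3 * β ^ 3 := by gcongr; exact one_le_pow₀ hβ
        refine Real.rpow_le_rpow (by positivity) ?_ (by norm_num)
        exact mul_le_mul_of_nonneg_right (by linarith) (by positivity)
      have h3 : H * √(3 / 5 * rho1 l H) ≤ H ^ 2 := by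
        rw [sq]; exact mul_le_mul_of_nonneg_left hsq hH
      have h4 : 0 ≤ rho1 l H ^ 3 := by positivity
      have h5 : (3 / 5 * rho1 l H) ^ 3 = 27 / 125 * rho1 l H ^ 3 := by ring
      rw [h5]
      unfold M0
      nlinarith

lemma two_mul_div_le_M3 {β l K₀ K₂ : ℝ} (hβ : 1 ≤ β) (hl : 1 ≤ l) :
    2 * (K₀ ^ 2 / l) ≤ M3 β l K₀ K₂ := by
  have hl0 : 0 < l := by linarith
  have h1 : l⁻¹ ≤ l ^ (-(3 / 4) : ℝ) := by
    rw [← Real.rpow_neg_one]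
    exact Real.rpow_le_rpow_of_exponent_le hl (by norm_num)
  have h2 : 1 ≤ β ^ 4 := one_le_pow₀ hβ
  have h3 : 2 * l⁻¹ ≤ 2 * β ^ 4 * l ^ (-(3 / 4) : ℝ) :=
    mul_le_mul (by linarith) h1 (by positivity) (by positivity)
  have h4 : 0 ≤ K₂ ^ 2 := sq_nonneg _
  calc 2 * (K₀ ^ 2 / l) = 2 * l⁻¹ * K₀ ^ 2 := by rw [div_eq_mul_inv]; ring
    _ ≤ 2 * β ^ 4 * l ^ (-(3 / 4) : ℝ) * (K₀ ^ 2 + 1 / 4 * K₂ ^ 2) :=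
      mul_le_mul h3 (by linarith) (sq_nonneg _) (by positivity)

/-! ### Synchronization of the feedback system -/

lemma PerAC.integrable {f f' : ℝ → ℝ} (h : PerAC f f') : Integrable f' circ := by
  obtain ⟨F, hF, -, -, hfF'⟩ := h
  have := hF.intervalIntegrable_deriv
  rw [intervalIntegrable_iff_integrableOn_Ioc_of_le zero_le_one] at this
  exact (integrable_congr hfF').2 this

/-- In the energy balance of a difference `f = u - v` the nonlinearity only contributes
`½ ∫ f² ∂ₓv`; the terms with `∂ₓu` cancel. -/
lemma integral_mul_sub_nonlinearity {u du v dv f e : L2} (hf : HasPerDeriv f e)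
    (hv : HasPerDeriv v dv) (h0 : MeanZero f) (hfu : f = u - v) (heu : e = du - dv) :
    ∫ x, f x * (u x * du x - v x * dv x) ∂circ = 1 / 2 * ∫ x, f x * (f x * dv x) ∂circ := by
  have a1 := (hf.perAC.mul hf.perAC).mul hf.perAC
  have a2 := (hf.perAC.mul hf.perAC).mul hv.perAC
  have i3 : Integrable (fun x => f x * (f x * dv x)) circ :=
    integrable_mul_of_memLp (memLp_coe f) (memLp_mul hf h0 dv)
  have i12 := (a1.integrable.const_mul (1 / 3)).add (a2.integrable.const_mul (1 / 2))
  have h := integral_add i12 (i3.const_mul (1 / 2))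
  rw [integral_add' (a1.integrable.const_mul (1 / 3)) (a2.integrable.const_mul (1 / 2)),
    integral_const_mul, integral_const_mul, integral_const_mul, a1.integral_eq_zero,
    a2.integral_eq_zero, mul_zero, mul_zero, add_zero, zero_add] at h
  refine (integral_congr_ae ?_).trans h
  filter_upwards [Lp.coeFn_sub u v, Lp.coeFn_sub du dv] with x h1 h2
  rw [← hfu, Pi.sub_apply] at h1
  rw [← heu, Pi.sub_apply] at h2
  simp only [Pi.add_apply]
  rw [show u x = v x + f x by linarith, show du x = dv x + e x by linarith]
  ring

lemma abs_integral_mul_mul_le {f e d : L2} (hf : HasPerDeriv f e) (h0 : MeanZero f) :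
    |∫ x, f x * (f x * d x) ∂circ| ≤ ‖f‖ * (√(‖f‖ * ‖e‖) * ‖d‖) := by
  refine (abs_integral_mul_le (memLp_coe f) (memLp_mul hf h0 d)).trans ?_
  rw [← norm_sq_eq, Real.sqrt_sq (norm_nonneg _)]
  refine mul_le_mul_of_nonneg_left ?_ (norm_nonneg _)
  refine (Real.sqrt_le_sqrt (integral_mul_sq_le hf h0 d)).trans ?_
  rw [Real.sqrt_mul (by positivity), Real.sqrt_sq (norm_nonneg _)]

/-- The weighted inequality of arithmetic and geometric means `(X A³)^(1/4) ≤ (X + 3A) / 4`. -/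
lemma le_of_pow_four_le {T X A : ℝ} (hX : 0 ≤ X) (hA : 0 ≤ A) (h : T ^ 4 ≤ X * A ^ 3) :
    T ≤ (X + 3 * A) / 4 := by
  refine le_of_pow_le_pow_left₀ (n := 4) (by norm_num) (by positivity) (h.trans ?_)
  rw [← sub_nonneg]
  have : ((X + 3 * A) / 4) ^ 4 - X * A ^ 3 =
      (X - A) ^ 2 * ((X + 7 * A) ^ 2 + 32 * A ^ 2) / 256 := by ring
  rw [this]
  positivity

/-- The nonlinear term is absorbed by the dissipation, here `‖e‖²`, and by the damping, which
contributes a multiple of `‖f‖²`. The fourth power of the integral is at most `K² ‖e‖² ‖f‖⁶`. -/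
lemma cubic_term_le {f e d : L2} (hf : HasPerDeriv f e) (h0 : MeanZero f) {K l : ℝ} (hl : 1 ≤ l)
    (hd : ‖d‖ ^ 2 ≤ K) (hp : l * ‖f‖ ^ 2 ≤ ‖e‖ ^ 2) :
    |∫ x, f x * (f x * d x) ∂circ| ≤ (K ^ 2 / l * ‖f‖ ^ 2 + 3 * ‖e‖ ^ 2) / 4 := by
  have hl0 : 0 < l := by linarith
  have hK : 0 ≤ K := (sq_nonneg _).trans hd
  refine le_of_pow_four_le (by positivity) (by positivity) ?_
  refine (pow_le_pow_left₀ (abs_nonneg _) (abs_integral_mul_mul_le hf h0) 4).trans ?_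
  set b := ‖f‖
  set a := ‖e‖
  have hx : √(b * a) ^ 4 = (b * a) ^ 2 := by
    rw [show √(b * a) ^ 4 = (√(b * a) ^ 2) ^ 2 by ring, Real.sq_sqrt (by positivity)]
  have h1 : (b * (√(b * a) * ‖d‖)) ^ 4 = b ^ 4 * (b * a) ^ 2 * (‖d‖ ^ 2) ^ 2 := by
    rw [← hx]; ring
  have h2 : (‖d‖ ^ 2) ^ 2 ≤ K ^ 2 := by gcongr
  have h3 : l * (b ^ 2) ^ 2 ≤ (a ^ 2) ^ 2 / l := by
    rw [le_div_iff₀ hl0]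
    calc l * (b ^ 2) ^ 2 * l = (l * b ^ 2) ^ 2 := by ring
      _ ≤ (a ^ 2) ^ 2 := by gcongr
  have h4 : (b ^ 2) ^ 2 ≤ (a ^ 2) ^ 2 / l :=
    (le_mul_of_one_le_left (by positivity) hl).trans h3
  rw [h1]
  calc b ^ 4 * (b * a) ^ 2 * (‖d‖ ^ 2) ^ 2 ≤ b ^ 4 * (b * a) ^ 2 * K ^ 2 := by gcongr
    _ = K ^ 2 * b ^ 2 * a ^ 2 * (b ^ 2) ^ 2 := by ring
    _ ≤ K ^ 2 * b ^ 2 * a ^ 2 * ((a ^ 2) ^ 2 / l) := by gcongr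
    _ = K ^ 2 / l * b ^ 2 * (a ^ 2) ^ 3 := by ring

section Synchronization

variable {w : ℕ → L2} {lam : ℕ → ℝ} {h : L2} {μ : ℝ} {N : ℕ} {v u : ℝ → L2}

lemma continuousOn_feedback (hv : ContinuousOn v (Set.Ici 0)) (hu : ContinuousOn u (Set.Ici 0)) :
    ContinuousOn (feedback h w μ N v u) (Set.Ici 0) := by
  unfold feedback
  fun_prop

/-- The energy of `u - v` decays at the rate `2` once `‖∂ₓv‖² ≤ K`: the modes up to `N` are damped by
the feedback, and the others by the dissipation. -/
lemma energy_rate_le (hw : IsEigenbasis w lam) (hv : IsSolution (fun _ => h) v)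
    (hu : IsSolution (feedback h w μ N v u) u) {K : ℝ} {t : ℝ} (ht : 0 ≤ t)
    (hK : ‖dx (v t)‖ ^ 2 ≤ K) (hμ : 2 * (K ^ 2 / lam 1) ≤ 2 * μ)
    (hN : (lam (N + 1))⁻¹ * (2 * (K ^ 2 / lam 1)) ≤ 1 / 2) :
    -2 * ‖dx (u t) - dx (v t)‖ ^ 2 + 2 * ∫ x, (u t - v t : L2) x *
      ((feedback h w μ N v u t x - u t x * dx (u t) x) - (h x - v t x * dx (v t) x)) ∂circ ≤
      -2 * ‖u t - v t‖ ^ 2 := by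
  have hmv := hv.mem t ht
  have hmu := hu.mem t ht
  have hdv := hmv.hasPerDeriv le_rfl
  have hdu := hmu.hasPerDeriv le_rfl
  have hf := hdu.sub hdv
  have h0 : MeanZero (u t - v t) := by
    have h1 := (meanZero_iff _).1 hmu.2
    have h2 := (meanZero_iff _).1 hmv.2
    rw [meanZero_iff, inner_sub_left, h1, h2, sub_zero]
  have hl := hw.le_lam le_rfl
  have hl0 : 0 < lam 1 := by linarith
  have hΛ := hw.le_lam (k := N + 1) (by omega)
  have hΛ0 : 0 < lam (N + 1) := by linarith
  have hgap := hw.spectral_gap hf h0 N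
  have hpoin := hw.poincare hf h0
  have hcub := neg_le_of_abs_le (cubic_term_le hf h0 (by linarith) hK hpoin)
  have hnl := integral_mul_sub_nonlinearity hf hdv h0 rfl rfl
  set f : L2 := u t - v t with hfdef
  set e : L2 := dx (u t) - dx (v t) with hedef
  set P : ℝ := ∑ k ∈ Finset.Icc 1 N, (inner ℝ f (w k) : ℝ) ^ 2 with hP
  have hP0 : 0 ≤ P := Finset.sum_nonneg fun k _ => sq_nonneg _
  have hfb : ∫ x, f x * (feedback h w μ N v u t - h : L2) x ∂circ = -μ * P := by
    rw [← inner_eq, feedback, ← hfdef, sub_sub_cancel_left, inner_neg_right, inner_smul_right,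
      inner_sum, hP, neg_mul]
    congr 2
    exact Finset.sum_congr rfl fun k _ => by rw [inner_smul_right, sq]
  have hsplit : ∫ x, f x *
      ((feedback h w μ N v u t x - u t x * dx (u t) x) - (h x - v t x * dx (v t) x)) ∂circ =
      -μ * P - 1 / 2 * ∫ x, f x * (f x * dx (v t) x) ∂circ := by
    have i1 := integrable_mul_of_memLp (memLp_coe f)
      (memLp_coe (feedback h w μ N v u t - h : L2))
    have i2 : Integrable (fun x => f x * (u t x * dx (u t) x - v t x * dx (v t) x)) circ :=
      integrable_mul_of_memLp (memLp_coe f)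
        ((memLp_mul hdu hmu.2 _).sub (memLp_mul hdv hmv.2 _))
    have h1 := integral_sub i1 i2
    rw [hfb, hnl] at h1
    refine (integral_congr_ae ?_).trans h1
    filter_upwards [Lp.coeFn_sub (feedback h w μ N v u t) h] with x hx
    rw [hx, Pi.sub_apply]
    ring
  rw [hsplit]
  set m : ℝ := K ^ 2 / lam 1 with hm
  have hm0 : 0 ≤ m := by positivity
  have h1 : m * (‖f‖ ^ 2 - P) ≤ ‖e‖ ^ 2 / 4 := by
    have h2 : m ≤ lam (N + 1) / 4 := by
      rw [inv_mul_le_iff₀ hΛ0] at hN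
      linarith
    rcases le_total 0 (‖f‖ ^ 2 - P) with hs | hs
    · calc m * (‖f‖ ^ 2 - P) ≤ lam (N + 1) / 4 * (‖f‖ ^ 2 - P) := by gcongr
        _ ≤ ‖e‖ ^ 2 / 4 := by linarith
    · exact (mul_nonpos_of_nonneg_of_nonpos hm0 hs).trans (by positivity)
  have h2 : m * P ≤ μ * P := mul_le_mul_of_nonneg_right (by linarith) hP0
  have h3 : 36 * ‖f‖ ^ 2 ≤ ‖e‖ ^ 2 := (by gcongr : 36 * ‖f‖ ^ 2 ≤ lam 1 * ‖f‖ ^ 2).trans hpoin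
  have h4 : 0 ≤ m * ‖f‖ ^ 2 := by positivity
  have h5 : 0 ≤ ‖f‖ ^ 2 := by positivity
  linarith

end Synchronization

end KdVB

theorem mainTheorem3 (β : ℝ) (hβ : KdVB.IsGNConst β)
    (w : ℕ → KdVB.L2) (lam : ℕ → ℝ) (hw : KdVB.IsEigenbasis w lam)
    (h : KdVB.L2) (hh : KdVB.MeanZero h) (μ : ℝ) (N : ℕ)
    (v u : ℝ → KdVB.L2)
    (hv : KdVB.IsSolution (fun _ => h) v)
    (hu : KdVB.IsSolution (KdVB.feedback h w μ N v u) u) :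
    (∀ᶠ t in atTop, ‖KdVB.dx (v t)‖ ^ 2 ≤ KdVB.M0 β (lam 1) ‖h‖) ∧
    ∀ K₀ K₂ : ℝ,
      (∀ᶠ t in atTop, ‖KdVB.dx (v t)‖ ^ 2 ≤ K₀) →
      (K₂ = KdVB.M2 β (lam 1) ‖h‖ μ K₀ ∨ ∀ᶠ t in atTop, ‖KdVB.dx (u t)‖ ^ 2 ≤ K₂) →
      KdVB.M3 β (lam 1) K₀ K₂ ≤ 2 * μ →
      (lam (N + 1))⁻¹ * KdVB.M3 β (lam 1) K₀ K₂ ≤ 1 / 2 →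
      ∃ T : ℝ, 0 ≤ T ∧ ∀ t, T ≤ t →
        ‖u t - v t‖ ≤ Real.exp (-(t - T)) * ‖u T - v T‖ := by
  have hβ1 := hβ.one_le hw
  have hl := hw.le_lam le_rfl
  refine ⟨?_, fun K₀ K₂ hK₀ _ hμ hN => ?_⟩
  · obtain ⟨R, hR, hRh, hRM⟩ := KdVB.exists_radius hβ1 hl (norm_nonneg h)
    exact hv.eventually_norm_dx_sq_le hw hR hRh hRM
  · have hM3 := KdVB.two_mul_div_le_M3 (K₀ := K₀) (K₂ := K₂) hβ1 (by linarith : 1 ≤ lam 1)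
    have hΛ := hw.le_lam (k := N + 1) (by omega)
    have hN' : (lam (N + 1))⁻¹ * (2 * (K₀ ^ 2 / lam 1)) ≤ 1 / 2 :=
      (mul_le_mul_of_nonneg_left hM3 (inv_nonneg.2 (by linarith))).trans hN
    obtain ⟨T₀, hT₀⟩ := eventually_atTop.1 hK₀
    have hT0 : 0 ≤ max T₀ 0 := le_max_right _ _
    have hF := KdVB.continuousOn_feedback (h := h) (w := w) (μ := μ) (N := N) hv.cont hu.cont
    have hms := (hu.isModeSolution hF).sub (hv.isModeSolution continuousOn_const)
    have hyc : ContinuousOn (fun t => ‖u t - v t‖ ^ 2) (Set.Ici 0) := hms.cont.norm.pow 2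
    refine ⟨max T₀ 0, hT0, fun t ht => ?_⟩
    have hdecay := KdVB.le_exp_mul_of_sub_le_integral (T := max T₀ 0)
      (hyc.mono (Set.Ici_subset_Ici.2 hT0)) (fun s t hs hst => ?_) ht
    · refine le_of_pow_le_pow_left₀ two_ne_zero (by positivity) (hdecay.trans_eq ?_)
      rw [mul_pow, ← Real.exp_nat_mul]
      congr 2
      push_cast
      ring
    · have hs0 : 0 ≤ s := hT0.trans hs
      obtain ⟨B₁, hB₁⟩ := hu.exists_bound_rhs hF (t := t) hs0
      obtain ⟨B₂, hB₂⟩ := hv.exists_bound_rhs continuousOn_const (t := t) hs0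
      refine hms.energy_le (B := (√B₁ + √B₂) ^ 2) hs0 hst
        (continuousOn_const.mul (hyc.mono fun τ hτ => hs0.trans hτ.1)) (fun τ hτ => ?_)
        fun τ hτ => ?_
      · have hτ0 := hs0.trans hτ.1
        refine (KdVB.integral_sub_sq_le ((hu.isModeSolution hF).memLp τ hτ0)
          ((hv.isModeSolution continuousOn_const).memLp τ hτ0)).trans ?_
        have h1 := Real.sqrt_le_sqrt (hB₁ τ hτ)
        have h2 := Real.sqrt_le_sqrt (hB₂ τ hτ)
        gcongr
      · exact KdVB.energy_rate_le hw hv hu (hs0.trans hτ.1)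
          (hT₀ τ ((le_max_left _ _).trans (hs.trans hτ.1))) (hM3.trans hμ) hN'
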